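/- Let $\mathbb{H}$ be the hyperbolic plane of curvature $-1$ with metric $d_{\mathbb{H}}$, and describe its points by hyperbolic polar coordinates $(r,\theta)$ around a fixed origin $O$. For $\alpha>0$, $\nu>0$ and an integer $n>\nu$ put $R=2\log(n/\nu)$, and let the $(\alpha,R)$-quasi-uniform distribution be the probability distribution of a point of $\mathbb{H}$ whose polar coordinates have density $$f_{\alpha,R}(r,\theta)=\frac{\alpha\sinh(\alpha r)}{2\pi(\cosh(\alpha R)-1)},\qquad 0\le r<R,\ 0<\theta\le 2\pi,$$ with respect to $dr\,d\theta$. Let $p_1,p_2,\dots$ be i.i.d. points with this distribution and let $Z$ be an independent Poisson random variable with mean $n$. The Poissonised KPKVB random graph $G_{\mathrm{Po}}(n;\alpha,\nu)$ has vertices $p_1,\dots,p_Z$ (so its vertex set is a Poisson point process of intensity $n f_{\alpha,R}$), and two distinct vertices $p,q$ are adjacent if and only if $d_{\mathbb{H}}(p,q)\le R$. A Hamilton cycle is a cycle through all vertices, and a near perfect matching is a matching that covers all but at most one vertex. **Theorem.** For every real $\alpha$ with $0<\alpha<\frac12$ there is $\nu_1=\nu_1(\alpha)>0$ such that for every $\nu>\nu_1$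 the random graph $G_{\mathrm{Po}}(n;\alpha,\nu)$ has a Hamilton cycle, and hence also a near perfect matching, with probability $1-o(n^{-1/2})$ as $n\to\infty$. -/

import Mathlib

open MeasureTheory ProbabilityTheory Filter Asymptotics
open scoped NNReal ENNReal UpperHalfPlane

namespace KPKVB

/-! ### The hyperbolic plane in polar coordinates

The hyperbolic plane is Mathlib's `ℍ` with its metric of curvature `-1`. The Poincaré disk is
identified with `ℍ` through the Cayley transform `z ↦ i (1 + z) / (1 - z)`, which sends the
origin of the disk to `i`. -/

lemma cayley_im (z : ℂ) :
    (Complex.I * (1 + z) / (1 - z)).im = (1 - Complex.normSq z) / Complex.normSq (1 - z) := by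
  simp only [Complex.div_im, Complex.mul_re, Complex.mul_im, Complex.I_re, Complex.I_im,
    Complex.add_re, Complex.add_im, Complex.sub_re, Complex.sub_im, Complex.one_re,
    Complex.one_im, Complex.normSq_apply]
  ring

/-- The point of the hyperbolic plane that is represented by the point `z` of the Poincaré disk. -/
noncomputable def ofDisc (z : ℂ) (hz : ‖z‖ < 1) : ℍ where
  coe := Complex.I * (1 + z) / (1 - z)
  coe_im_pos := by
    rw [cayley_im]
    have h1 : (1 : ℂ) - z ≠ 0 := by
      intro h
      rw [← sub_eq_zero.mp h] at hz
      simp at hz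
    have h2 : Complex.normSq z < 1 := by
      rw [Complex.normSq_eq_norm_sq]
      nlinarith [norm_nonneg z]
    exact div_pos (by linarith) (Complex.normSq_pos.mpr h1)

lemma norm_tanh_mul_exp_lt_one (r θ : ℝ) :
    ‖(Real.tanh (r / 2) : ℂ) * Complex.exp (θ * Complex.I)‖ < 1 := by
  rw [norm_mul, Complex.norm_exp_ofReal_mul_I, mul_one, Complex.norm_real, Real.norm_eq_abs,
    abs_lt]
  exact ⟨Real.neg_one_lt_tanh _, Real.tanh_lt_one _⟩

/-- The point with hyperbolic polar coordinates `(r, θ)`: in the Poincaré disk it is the point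
`tanh (r / 2) * exp (i θ)`, at hyperbolic distance `r` from the origin. -/
noncomputable def polarPoint (p : ℝ × ℝ) : ℍ :=
  ofDisc ((Real.tanh (p.1 / 2) : ℂ) * Complex.exp (p.2 * Complex.I))
    (norm_tanh_mul_exp_lt_one p.1 p.2)

lemma cosh_dist_ofDisc (z w : ℂ) (hz : ‖z‖ < 1) (hw : ‖w‖ < 1) :
    Real.cosh (dist (ofDisc z hz) (ofDisc w hw)) =
      1 + 2 * Complex.normSq (z - w) / ((1 - Complex.normSq z) * (1 - Complex.normSq w)) := by
  have aux : ∀ u : ℂ, ‖u‖ < 1 → (1 : ℂ) - u ≠ 0 ∧ 0 < 1 - Complex.normSq u := by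
    intro u hu
    refine ⟨fun h => ?_, ?_⟩
    · rw [← sub_eq_zero.mp h] at hu
      simp at hu
    · rw [Complex.normSq_eq_norm_sq]
      nlinarith [norm_nonneg u]
  obtain ⟨z1, z2⟩ := aux z hz
  obtain ⟨w1, w2⟩ := aux w hw
  have hzim : (ofDisc z hz).im = (1 - Complex.normSq z) / Complex.normSq (1 - z) := cayley_im z
  have hwim : (ofDisc w hw).im = (1 - Complex.normSq w) / Complex.normSq (1 - w) := cayley_im w
  have hd : ((ofDisc z hz : ℍ) : ℂ) - (ofDisc w hw : ℍ) =
      2 * Complex.I * (z - w) / ((1 - z) * (1 - w)) := by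
    change Complex.I * (1 + z) / (1 - z) - Complex.I * (1 + w) / (1 - w) = _
    field_simp
    ring
  rw [UpperHalfPlane.cosh_dist, hzim, hwim, Complex.dist_eq, ← Complex.normSq_eq_norm_sq, hd]
  have n1 := Complex.normSq_pos.mpr z1
  have n2 := Complex.normSq_pos.mpr w1
  simp only [map_mul, map_div₀, Complex.normSq_I, Complex.normSq_ofNat]
  field_simp

/-- The hyperbolic law of cosines, which confirms that `polarPoint` is given by hyperbolic polar
coordinates. -/
lemma cosh_dist_polarPoint (p q : ℝ × ℝ) :
    Real.cosh (dist (polarPoint p) (polarPoint q)) =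
      Real.cosh p.1 * Real.cosh q.1 - Real.sinh p.1 * Real.sinh q.1 * Real.cos (p.2 - q.2) := by
  have hz := norm_tanh_mul_exp_lt_one p.1 p.2
  have hw := norm_tanh_mul_exp_lt_one q.1 q.2
  unfold polarPoint
  rw [cosh_dist_ofDisc]
  have key : ∀ r θ : ℝ, Complex.normSq ((Real.tanh (r / 2) : ℂ) * Complex.exp (θ * Complex.I)) =
      Real.tanh (r / 2) ^ 2 := by
    intro r θ
    rw [Complex.normSq_eq_norm_sq, norm_mul, Complex.norm_exp_ofReal_mul_I, mul_one,
      Complex.norm_real, Real.norm_eq_abs, sq_abs]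
  have key2 : Complex.normSq ((Real.tanh (p.1 / 2) : ℂ) * Complex.exp (p.2 * Complex.I) -
      (Real.tanh (q.1 / 2) : ℂ) * Complex.exp (q.2 * Complex.I)) =
      Real.tanh (p.1 / 2) ^ 2 + Real.tanh (q.1 / 2) ^ 2 -
        2 * Real.tanh (p.1 / 2) * Real.tanh (q.1 / 2) * Real.cos (p.2 - q.2) := by
    rw [Complex.normSq_sub, key, key, map_mul, Complex.conj_ofReal, ← Complex.exp_conj, map_mul,
      Complex.conj_ofReal, Complex.conj_I]
    have : (Real.tanh (p.1 / 2) : ℂ) * Complex.exp (p.2 * Complex.I) *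
        ((Real.tanh (q.1 / 2) : ℂ) * Complex.exp (q.2 * -Complex.I)) =
        ((Real.tanh (p.1 / 2) * Real.tanh (q.1 / 2) : ℝ) : ℂ) *
          Complex.exp (((p.2 - q.2 : ℝ) : ℂ) * Complex.I) := by
      rw [show (((p.2 - q.2 : ℝ) : ℂ) * Complex.I) = p.2 * Complex.I + q.2 * -Complex.I by
        push_cast; ring, Complex.exp_add]
      push_cast
      ring
    rw [this, Complex.re_ofReal_mul, Complex.exp_ofReal_mul_I_re]
    ring
  rw [key, key, key2]
  have ch : ∀ r : ℝ, Real.cosh r = 2 * Real.cosh (r / 2) ^ 2 - 1 := by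
    intro r
    have h := Real.cosh_two_mul (r / 2)
    rw [mul_div_cancel₀ r two_ne_zero] at h
    rw [h, Real.sinh_sq]
    ring
  have sh : ∀ r : ℝ, Real.sinh r = 2 * Real.sinh (r / 2) * Real.cosh (r / 2) := by
    intro r
    have h := Real.sinh_two_mul (r / 2)
    rwa [mul_div_cancel₀ r two_ne_zero] at h
  rw [ch p.1, ch q.1, sh p.1, sh q.1, Real.tanh_eq_sinh_div_cosh, Real.tanh_eq_sinh_div_cosh]
  have c1 := Real.cosh_pos (p.1 / 2)
  have c2 := Real.cosh_pos (q.1 / 2)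
  have e1 := Real.sinh_sq (p.1 / 2)
  have e2 := Real.sinh_sq (q.1 / 2)
  generalize Real.cosh (p.1 / 2) = a at *
  generalize Real.cosh (q.1 / 2) = b at *
  generalize Real.sinh (p.1 / 2) = s at *
  generalize Real.sinh (q.1 / 2) = t at *
  have d1 : 1 - (s / a) ^ 2 = 1 / a ^ 2 := by
    field_simp
    linarith
  have d2 : 1 - (t / b) ^ 2 = 1 / b ^ 2 := by
    field_simp
    linarith
  rw [d1, d2]
  field_simp
  rw [e1, e2]
  ring

/-! ### The Poissonised graph -/

/-- The radius `R = 2 log (n / ν)` of the disk. -/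
noncomputable def radius (ν : ℝ) (n : ℕ) : ℝ := 2 * Real.log (n / ν)

/-- The `(α, R)`-quasi-uniform distribution on the hyperbolic disk of radius `R` around the
origin, in polar coordinates `(r, θ)`. -/
noncomputable def quasiUniform (α R : ℝ) : Measure (ℝ × ℝ) :=
  (volume.restrict (Set.Ico 0 R ×ˢ Set.Ioc 0 (2 * Real.pi))).withDensity fun p =>
    ENNReal.ofReal (α * Real.sinh (α * p.1) / (2 * Real.pi * (Real.cosh (α * R) - 1)))

lemma isProbabilityMeasure_quasiUniform {α R : ℝ} (hα : 0 < α) (hR : 0 < R) :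
    IsProbabilityMeasure (quasiUniform α R) := by
  have hαR : 0 < α * R := mul_pos hα hR
  have hc : 0 < Real.cosh (α * R) - 1 := by
    have := Real.one_lt_cosh.mpr hαR.ne'
    linarith
  have hpi := Real.pi_pos
  constructor
  set f : ℝ → ℝ := fun r => α * Real.sinh (α * r) / (2 * Real.pi * (Real.cosh (α * R) - 1))
    with hf
  have hfc : Continuous f := by
    rw [hf]
    fun_prop
  have hf0 : ∀ r ∈ Set.Ico 0 R, 0 ≤ f r := fun r hr =>
    div_nonneg (mul_nonneg hα.le (Real.sinh_nonneg_iff.mpr (mul_nonneg hα.le hr.1)))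
      (by positivity)
  have hint : ∫ r in (0 : ℝ)..R, f r = 1 / (2 * Real.pi) := by
    have hder : ∀ r ∈ Set.uIcc (0 : ℝ) R, HasDerivAt
        (fun r => Real.cosh (α * r) / (2 * Real.pi * (Real.cosh (α * R) - 1))) (f r) r := by
      intro r _
      have h := ((Real.hasDerivAt_cosh (α * r)).comp r
        ((hasDerivAt_id r).const_mul α)).div_const (2 * Real.pi * (Real.cosh (α * R) - 1))
      have e : f r = Real.sinh (α * r) * (α * 1) /
          (2 * Real.pi * (Real.cosh (α * R) - 1)) := by
        rw [hf]
        ring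
      rw [e]
      exact h
    rw [intervalIntegral.integral_eq_sub_of_hasDerivAt hder (hfc.intervalIntegrable _ _)]
    simp only [mul_zero, Real.cosh_zero]
    field_simp
  have hlin : ∫⁻ r in Set.Ico 0 R, ENNReal.ofReal (f r) = ENNReal.ofReal (1 / (2 * Real.pi)) := by
    rw [← ofReal_integral_eq_lintegral_ofReal, integral_Ico_eq_integral_Ioo,
      ← integral_Ioc_eq_integral_Ioo, ← intervalIntegral.integral_of_le hR.le, hint]
    · exact (hfc.continuousOn.integrableOn_Icc (a := 0) (b := R)).mono_set Set.Ico_subset_Icc_self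
    · filter_upwards [ae_restrict_mem measurableSet_Ico] with r hr using hf0 r hr
  have hm : Measurable fun r => ENNReal.ofReal (f r) := hfc.measurable.ennreal_ofReal
  rw [quasiUniform, withDensity_apply _ MeasurableSet.univ, Measure.restrict_univ,
    Measure.volume_eq_prod, ← Measure.prod_restrict]
  change ∫⁻ p : ℝ × ℝ, ENNReal.ofReal (f p.1) ∂_ = 1
  rw [lintegral_prod (fun p : ℝ × ℝ => ENNReal.ofReal (f p.1))
    (hm.comp measurable_fst).aemeasurable]
  change ∫⁻ r in Set.Ico 0 R, ∫⁻ _ in Set.Ioc 0 (2 * Real.pi), ENNReal.ofReal (f r) = 1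
  simp only [lintegral_const, Measure.restrict_apply MeasurableSet.univ, Set.univ_inter,
    Real.volume_Ioc, sub_zero]
  rw [lintegral_mul_const _ hm, hlin, ← ENNReal.ofReal_mul (by positivity)]
  rw [one_div_mul_cancel (by positivity), ENNReal.ofReal_one]

/-- The sample space of the Poissonised model with its law: a Poisson variable `Z` of mean `n` and,
independently of it, an infinite sequence of i.i.d. quasi-uniform points `p 0, p 1, …`, that is,
a pair `(Z, p)`. The vertices of the random graph are the first `Z` of these points.
The radius is positive, and this is a probability measure, once `n > ν > 0`. -/
noncomputable def poissonLaw (α ν : ℝ) (n : ℕ) : Measure (ℕ × (ℕ → ℝ × ℝ)) :=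
  (poissonMeasure (n : ℝ≥0)).prod
    (Measure.infinitePi fun _ : ℕ => quasiUniform α (radius ν n))

lemma isProbabilityMeasure_poissonLaw {α ν : ℝ} {n : ℕ} (hα : 0 < α) (hν : 0 < ν)
    (hn : ν < n) : IsProbabilityMeasure (poissonLaw α ν n) := by
  have hR : 0 < radius ν n :=
    mul_pos two_pos (Real.log_pos ((one_lt_div hν).mpr hn))
  have := isProbabilityMeasure_quasiUniform hα hR
  unfold poissonLaw
  infer_instance

/-- The geometric graph on points given in polar coordinates: two different vertices are joined
if their hyperbolic distance is at most `R`. -/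
def diskGraph {V : Type*} (R : ℝ) (p : V → ℝ × ℝ) : SimpleGraph V where
  Adj v w := v ≠ w ∧ dist (polarPoint (p v)) (polarPoint (p w)) ≤ R
  symm := ⟨fun _ _ h => ⟨h.1.symm, by rw [dist_comm]; exact h.2⟩⟩
  loopless := ⟨fun _ h => h.1 rfl⟩

/-- The Poissonised graph at the sample point `ω = (Z, p)`. -/
noncomputable def poissonGraph (ν : ℝ) (n : ℕ) (ω : ℕ × (ℕ → ℝ × ℝ)) : SimpleGraph (Fin ω.1) :=
  diskGraph (radius ν n) fun i : Fin ω.1 => ω.2 i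

/-- The graph contains a Hamilton cycle (in particular, it has at least three vertices). -/
def HasHamiltonCycle {V : Type*} [DecidableEq V] (G : SimpleGraph V) : Prop :=
  ∃ (v : V) (c : G.Walk v v), c.IsHamiltonianCycle

/-- The graph has a matching that covers all vertices but at most one. -/
def HasNearPerfectMatching {V : Type*} (G : SimpleGraph V) : Prop :=
  ∃ M : G.Subgraph, M.IsMatching ∧ (M.vertsᶜ).Subsingleton

end KPKVB

/-! Put x = n/ν, so that e^R = x². The disk is cut into about x thin sectors, and a point at radius
r gets the level ⌊log₄ e^(R - r)⌋, capped at the top. A node of level i is a block of 2^i sectors,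
and the nodes form a forest of binary trees. Points of one block of level j differ in angle by at
most 2^j / x, so the law of cosines makes a point at a node adjacent to every point at or below this
node (`dist_le_of_node_mem_subtree`). Points at the top level have radius at most R/2 and form a
clique.

Hence paths can be joined from the bottom upwards: every point at a node links two of the paths that
cover the trees below it. If every top node has more points than there are paths arriving from
below, then each tree has a spanning path with both ends at the top. The clique concatenates these
paths and closes the result to a Hamilton cycle; every other edge of the path gives the matching
(`hasHamiltonCycle_of_forest`).

By `poisson_thinning` the counts X at the nodes are independent Poisson variables. The mean at level
i is at least (να/32) · 4^((1/2 - α) i) by `le_quasiUniform_node`. Since α < 1/2 this does not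
decrease with i, so a large ν gives E 2^(-X) ≤ 1/8 at all nodes simultaneously. The number Y of
paths then satisfies E 2^Y ≤ 2 + 4 · 4 / 8 = 4 by induction on the level, whatever the height
(`lintegral_two_pow_pathNumber_le`). At the top the mean is at least of order x^(1/2 - α), so by
Markov's inequality a top node fails with probability at most 16 exp(-(να/64) x^(1/2 - α)). A union
bound over at most 8x top nodes beats every power of n. -/

namespace KPKVB

/-! ### Covering a graph by paths -/

section Paths

variable {V : Type*} {G : SimpleGraph V}

/-- The set `A` of vertices is partitioned by the vertex sets of at most `d` paths. -/
def PathCover (G : SimpleGraph V) (A : Set V) (d : ℕ) : Prop :=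
  ∃ L : List (List V), L.length ≤ d ∧ (∀ l ∈ L, l ≠ [] ∧ l.IsChain G.Adj) ∧ L.flatten.Nodup ∧
    ∀ v, v ∈ L.flatten ↔ v ∈ A

/-- There is a path with vertex set `A` whose two ends lie in `K`. -/
def SpanningPath (G : SimpleGraph V) (A K : Set V) : Prop :=
  ∃ l : List V, l ≠ [] ∧ l.IsChain G.Adj ∧ l.Nodup ∧ (∀ v, v ∈ l ↔ v ∈ A) ∧
    (∀ x ∈ l.head?, x ∈ K) ∧ ∀ x ∈ l.getLast?, x ∈ K

lemma PathCover.mono {A : Set V} {d e : ℕ} (h : PathCover G A d) (hde : d ≤ e) :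
    PathCover G A e := by
  obtain ⟨L, h1, h2⟩ := h
  exact ⟨L, h1.trans hde, h2⟩

lemma PathCover.union {A B : Set V} {d e : ℕ} (hA : PathCover G A d) (hB : PathCover G B e)
    (hAB : Disjoint A B) : PathCover G (A ∪ B) (d + e) := by
  obtain ⟨L, h1, h2, h3, h4⟩ := hA
  obtain ⟨M, k1, k2, k3, k4⟩ := hB
  refine ⟨L ++ M, by simpa using add_le_add h1 k1, ?_, ?_, ?_⟩
  · intro l hl
    rcases List.mem_append.mp hl with h | h
    exacts [h2 l h, k2 l h]
  · rw [List.flatten_append, List.nodup_append]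
    refine ⟨h3, k3, fun a ha b hb hab => ?_⟩
    exact Set.disjoint_left.mp hAB ((h4 a).mp ha) ((k4 a).mp (hab ▸ hb))
  · intro v
    rw [List.flatten_append, List.mem_append, h4, k4, Set.mem_union]

/-- The new vertex is put between the end of one path and the start of another. A single path is
extended by it, and if there is no path it becomes one itself; this is why the bound stops at 1. -/
lemma PathCover.insert {A : Set V} {d : ℕ} (h : PathCover G A d) {x : V} (hx : x ∉ A)
    (hadj : ∀ a ∈ A, G.Adj x a) : PathCover G (insert x A) (max 1 (d - 1)) := by
  obtain ⟨L, h1, h2, h3, h4⟩ := h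
  match L, h1, h2, h3, h4 with
  | [], h1, h2, h3, h4 =>
    refine ⟨[[x]], by simp, by simp, by simp, fun v => ?_⟩
    have := h4 v
    simp_all
  | [l], h1, h2, h3, h4 =>
    have hl := h2 l (by simp)
    refine ⟨[l ++ [x]], by simp, ?_, ?_, fun v => ?_⟩
    · simp only [List.mem_singleton, forall_eq]
      refine ⟨by simp, List.isChain_append.mpr ⟨hl.2, by simp, ?_⟩⟩
      intro y hy z hz
      have : y ∈ l := List.mem_of_getLast? hy
      simp only [List.head?_cons, Option.mem_def, Option.some.injEq] at hz
      subst hz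
      exact (hadj y ((h4 y).mp (by simpa using this))).symm
    · have := h4 x
      simp only [List.flatten_cons, List.flatten_nil, List.append_nil] at *
      rw [List.nodup_append]
      refine ⟨h3, by simp, ?_⟩
      grind
    · have := h4 v
      simp only [List.flatten_cons, List.flatten_nil, List.append_nil, List.mem_append,
        List.mem_singleton, Set.mem_insert_iff] at *
      rw [this, or_comm]
  | l :: m :: L, h1, h2, h3, h4 =>
    have hl := h2 l (by simp)
    have hm := h2 m (by simp)
    refine ⟨(l ++ x :: m) :: L, ?_, ?_, ?_, fun v => ?_⟩
    · simp only [List.length_cons] at *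
      omega
    · intro k hk
      rcases List.mem_cons.mp hk with rfl | hk
      · refine ⟨by simp, List.isChain_append.mpr ⟨hl.2, List.isChain_cons.mpr ⟨?_, hm.2⟩, ?_⟩⟩
        · intro y hy
          have : y ∈ m := List.mem_of_head? hy
          exact hadj y ((h4 y).mp (by simp [this]))
        · intro y hy z hz
          have : y ∈ l := List.mem_of_getLast? hy
          simp only [List.head?_cons, Option.mem_def, Option.some.injEq] at hz
          subst hz
          exact (hadj y ((h4 y).mp (by simp [this]))).symm
      · exact h2 k (by simp [hk])
    · have hp : ((l ++ x :: m) :: L).flatten.Perm (x :: (l :: m :: L).flatten) := by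
        simp only [List.flatten_cons, List.append_assoc, List.cons_append]
        exact List.perm_middle
      rw [hp.nodup_iff, List.nodup_cons]
      exact ⟨fun hh => hx ((h4 x).mp hh), h3⟩
    · have hp : ((l ++ x :: m) :: L).flatten.Perm (x :: (l :: m :: L).flatten) := by
        simp only [List.flatten_cons, List.append_assoc, List.cons_append]
        exact List.perm_middle
      rw [hp.mem_iff, List.mem_cons, h4, Set.mem_insert_iff]

lemma PathCover.union_finset {A : Set V} {d : ℕ} (h : PathCover G A d) (B : Finset V)
    (hAB : ∀ x ∈ B, x ∉ A)
    (hadj : ∀ x ∈ B, ∀ a, a ∈ A ∨ a ∈ B → x ≠ a → G.Adj x a) :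
    PathCover G (A ∪ B) (max 1 (d - B.card)) := by
  classical
  induction B using Finset.induction_on with
  | empty =>
    simp only [Finset.coe_empty, Set.union_empty, Finset.card_empty, Nat.sub_zero]
    exact h.mono (le_max_right _ _)
  | insert x B hx ih =>
    have ih' := ih (fun y hy => hAB y (by simp [hy]))
      (fun y hy a ha => hadj y (by simp [hy]) a (by
        rcases ha with ha | ha
        · exact Or.inl ha
        · exact Or.inr (by simp [ha])))
    have h1 := ih'.insert (x := x) (by
      have := hAB x (by simp)
      simp [this, hx]) (by
      intro a ha
      refine hadj x (by simp) a ?_ ?_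
      · rcases ha with ha | ha
        · exact Or.inl ha
        · exact Or.inr (by simp [Finset.mem_coe.mp ha])
      · rintro rfl
        rcases ha with ha | ha
        · exact hAB x (by simp) ha
        · exact hx ha)
    rw [Finset.coe_insert, Set.union_insert]
    refine h1.mono ?_
    rw [Finset.card_insert_of_notMem hx]
    omega

/-- The path `l` grows while both its ends stay in `K`. Its last vertex is adjacent to everything,
so a further path can be appended directly, and a fresh vertex of `B` after it restores the end in
`K`. Each path of `L` costs one vertex of `B`. -/
lemma spanningPath_of_anchored {K : Set V} (B : Finset V) (l : List V) (L : List (List V))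
    (hl : l ≠ []) (hchain : ∀ m ∈ l :: L, m.IsChain G.Adj) (hnd : (l :: L).flatten.Nodup)
    (hhead : ∀ x ∈ l.head?, x ∈ K) (hlast : ∀ x ∈ l.getLast?, x ∈ K)
    (hB : ∀ x ∈ B, x ∉ (l :: L).flatten) (hBK : (B : Set V) ⊆ K) (hcard : L.length ≤ B.card)
    (hadj : ∀ x ∈ K, ∀ a, a ∈ (l :: L).flatten ∨ a ∈ B → x ≠ a → G.Adj x a) :
    SpanningPath G ({v | v ∈ (l :: L).flatten} ∪ B) K := by
  classical
  induction B using Finset.induction_on generalizing l L with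
  | empty =>
    have : L = [] := by simpa using hcard
    subst this
    refine ⟨l, hl, hchain l (by simp), by simpa using hnd, by simp, hhead, hlast⟩
  | insert b B hb ih =>
    have hbK : b ∈ K := hBK (by simp)
    have hbl : b ∉ (l :: L).flatten := hB b (by simp)
    -- Once `L` is used up, `m` is the empty list and `b` alone is appended, so that surplus
    -- vertices of `B` are absorbed as well.
    obtain ⟨m, L', hm, hlen, hmc⟩ : ∃ (m : List V) (L' : List (List V)),
        (l :: L).flatten = l ++ m ++ L'.flatten ∧ L'.length ≤ B.card ∧
          (m.IsChain G.Adj ∧ ∀ k ∈ L', k.IsChain G.Adj) := by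
      match L, hcard, hchain with
      | [], _, _ => exact ⟨[], [], by simp, by simp, by simp⟩
      | m :: L', hcard, hchain =>
        refine ⟨m, L', by simp, ?_, hchain m (by simp), fun k hk => hchain k (by simp [hk])⟩
        rw [Finset.card_insert_of_notMem hb] at hcard
        simpa using hcard
    have hp : ((l ++ m ++ [b]) :: L').flatten.Perm (b :: (l :: L).flatten) := by
      rw [hm, List.flatten_cons, List.append_assoc (l ++ m)]
      exact List.perm_middle
    have hc : (l ++ m ++ [b]).IsChain G.Adj := by
      refine List.isChain_append.mpr ⟨List.isChain_append.mpr
        ⟨hchain l (by simp), hmc.1, ?_⟩, by simp, ?_⟩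
      · intro x hx y hy
        refine hadj x (hlast x hx) y (Or.inl ?_) ?_
        · rw [hm]
          simp [List.mem_of_head? hy]
        · rintro rfl
          rw [hm, List.nodup_append, List.nodup_append] at hnd
          exact hnd.1.2.2 x (List.mem_of_getLast? hx) x (List.mem_of_head? hy) rfl
      · intro x hx y hy
        simp only [List.head?_cons, Option.mem_def, Option.some.injEq] at hy
        subst hy
        have hx' : x ∈ (l :: L).flatten := by
          rw [hm]
          exact List.mem_append_left _ (List.mem_of_getLast? hx)
        exact (hadj b hbK x (Or.inl hx') (by rintro rfl; exact hbl hx')).symm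
    have key := ih (l ++ m ++ [b]) L' (by simp) (by
        intro k hk
        rcases List.mem_cons.mp hk with rfl | hk
        exacts [hc, hmc.2 k hk])
      (by rw [hp.nodup_iff, List.nodup_cons]; exact ⟨hbl, hnd⟩)
      (by
        intro x hx
        refine hhead x ?_
        rw [List.append_assoc, List.head?_append_of_ne_nil _ hl] at hx
        exact hx)
      (by simp [hbK])
      (by
        intro x hx hx'
        rw [hp.mem_iff, List.mem_cons] at hx'
        rcases hx' with rfl | hx'
        · exact hb hx
        · exact hB x (by simp [hx]) hx')
      (fun x hx => hBK (by simp [Finset.mem_coe.mp hx])) hlen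
      (by
        intro x hx a ha
        refine hadj x hx a ?_
        rw [hp.mem_iff, List.mem_cons] at ha
        rcases ha with (rfl | ha) | ha
        · exact Or.inr (by simp)
        · exact Or.inl ha
        · exact Or.inr (by simp [ha]))
    convert key using 1
    ext v
    simp only [Set.mem_union, Set.mem_ofPred_eq, hp.mem_iff, List.mem_cons, Finset.coe_insert,
      Set.mem_insert_iff]
    tauto

/-- One vertex of `B` is the initial anchored path and each of the at most `d` paths consumes
another, hence the strict inequality. -/
lemma PathCover.spanningPath {A : Set V} {d : ℕ} (h : PathCover G A d) (B : Finset V)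
    (hd : d < B.card) (hAB : ∀ x ∈ B, x ∉ A)
    (hadj : ∀ x ∈ B, ∀ a, a ∈ A ∨ a ∈ B → x ≠ a → G.Adj x a) :
    SpanningPath G (A ∪ B) B := by
  classical
  obtain ⟨L, h1, h2, h3, h4⟩ := h
  obtain ⟨b, hb⟩ := Finset.card_pos.mp (Nat.zero_lt_of_lt hd)
  have hbA : b ∉ L.flatten := fun hh => hAB b hb ((h4 b).mp hh)
  have hmem : ∀ v, v ∈ ([b] :: L).flatten ↔ v = b ∨ v ∈ A := by
    intro v
    rw [List.flatten_cons, List.mem_append, List.mem_singleton, h4]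
  have key := spanningPath_of_anchored (G := G) (K := B) (B.erase b) [b] L (by simp)
    (by
      intro m hm
      rcases List.mem_cons.mp hm with rfl | hm
      exacts [by simp, (h2 m hm).2])
    (by
      rw [List.flatten_cons, List.singleton_append, List.nodup_cons]
      exact ⟨hbA, h3⟩)
    (by simp [hb]) (by simp [hb])
    (by
      intro x hx hx'
      rw [hmem] at hx'
      rw [Finset.mem_erase] at hx
      rcases hx' with hx' | hx'
      exacts [hx.1 hx', hAB x hx.2 hx'])
    (by simp)
    (by rw [Finset.card_erase_of_mem hb]; omega)
    (by
      intro x hx a ha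
      refine hadj x hx a ?_
      rw [hmem, Finset.mem_erase] at ha
      rcases ha with (rfl | ha) | ha
      exacts [Or.inr hb, Or.inl ha, Or.inr ha.2])
  convert key using 1
  ext v
  simp only [Set.mem_union, Set.mem_ofPred_eq, hmem, Finset.coe_erase, Set.mem_sdiff,
    Set.mem_singleton_iff, Finset.mem_coe]
  by_cases hv : v = b
  · simp [hv, hb]
  · simp [hv]

lemma SpanningPath.mono {A K K' : Set V} (h : SpanningPath G A K) (hK : K ⊆ K') :
    SpanningPath G A K' := by
  obtain ⟨l, h1, h2, h3, h4, h5, h6⟩ := h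
  exact ⟨l, h1, h2, h3, h4, fun x hx => hK (h5 x hx), fun x hx => hK (h6 x hx)⟩

lemma SpanningPath.union {A B K : Set V} (hA : SpanningPath G A K) (hB : SpanningPath G B K)
    (hAB : Disjoint A B) (hK : G.IsClique K) : SpanningPath G (A ∪ B) K := by
  obtain ⟨l, h1, h2, h3, h4, h5, h6⟩ := hA
  obtain ⟨m, k1, k2, k3, k4, k5, k6⟩ := hB
  have hd : ∀ a ∈ l, ∀ b ∈ m, a ≠ b := fun a ha b hb hab =>
    Set.disjoint_left.mp hAB ((h4 a).mp ha) ((k4 a).mp (hab ▸ hb))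
  refine ⟨l ++ m, by simp [h1], List.isChain_append.mpr ⟨h2, k2, fun x hx y hy => ?_⟩,
    List.nodup_append.mpr ⟨h3, k3, hd⟩, fun v => ?_, ?_, ?_⟩
  · exact hK (h6 x hx) (k5 y hy) (hd x (List.mem_of_getLast? hx) y (List.mem_of_head? hy))
  · rw [List.mem_append, h4, k4, Set.mem_union]
  · rwa [List.head?_append_of_ne_nil _ h1]
  · rwa [List.getLast?_append_of_ne_nil _ k1]

/-- The ends of the path are adjacent because `K` is a clique. With at least three vertices they are
distinct, and the closing edge is not already an edge of the path. -/
lemma SpanningPath.hasHamiltonCycle [Fintype V] [DecidableEq V] {K : Set V}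
    (h : SpanningPath G Set.univ K) (hK : G.IsClique K) (hcard : 3 ≤ Fintype.card V) :
    HasHamiltonCycle G := by
  obtain ⟨l, h1, h2, h3, h4, h5, h6⟩ := h
  have hlen : l.length = Fintype.card V := by
    rw [← List.toFinset_card_of_nodup h3, ← Finset.card_univ]
    congr 1
    ext v
    simp [h4]
  set p := SimpleGraph.Walk.ofSupport l h1 h2 with hp
  have hne : l.head h1 ≠ l.getLast h1 := by
    rw [List.head_eq_getElem, List.getLast_eq_getElem]
    intro hh
    have := (List.Nodup.getElem_inj_iff h3).mp hh
    omega
  have hadj : G.Adj (l.getLast h1) (l.head h1) :=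
    hK (h6 _ (List.getLast_mem_getLast? h1)) (h5 _ (List.head_mem_head? h1)) hne.symm
  have hsupp : p.support = l := SimpleGraph.Walk.support_ofSupport h1 h2
  have hpath : p.IsPath := by
    rw [SimpleGraph.Walk.isPath_def, hsupp]
    exact h3
  refine ⟨_, SimpleGraph.Walk.cons hadj p, ?_⟩
  rw [SimpleGraph.Walk.isHamiltonianCycle_iff_isCycle_and_length_eq]
  have hpl : p.length = l.length - 1 := SimpleGraph.Walk.length_ofSupport h1 h2
  constructor
  · rw [SimpleGraph.Walk.cons_isCycle_iff]
    refine ⟨hpath, fun he => ?_⟩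
    have := hpath.length_eq_one_of_mem_edges (by rwa [Sym2.eq_swap])
    omega
  · rw [SimpleGraph.Walk.length_cons, hpl]
    omega

/-- Consecutive vertices are paired off from the start of the path; at most the last vertex is left
over. -/
lemma exists_isMatching_of_isChain [DecidableEq V] : ∀ l : List V, l.IsChain G.Adj → l.Nodup →
    ∃ M : G.Subgraph, M.IsMatching ∧ (∀ v ∈ M.verts, v ∈ l) ∧
      {v | v ∈ l ∧ v ∉ M.verts}.Subsingleton
  | [], _, _ => ⟨⊥, by simp [SimpleGraph.Subgraph.IsMatching], by simp, by simp⟩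
  | [a], _, _ => ⟨⊥, by simp [SimpleGraph.Subgraph.IsMatching], by simp, by simp⟩
  | a :: b :: l, hc, hn => by
    rw [List.isChain_cons_cons] at hc
    have hn' := hn
    rw [List.nodup_cons, List.nodup_cons] at hn'
    obtain ⟨M, h1, h2, h3⟩ := exists_isMatching_of_isChain l hc.2.tail hn'.2.2
    refine ⟨M ⊔ G.subgraphOfAdj hc.1, h1.sup (.subgraphOfAdj hc.1) ?_, ?_, ?_⟩
    · rw [h1.support_eq_verts, (SimpleGraph.Subgraph.IsMatching.subgraphOfAdj hc.1).support_eq_verts,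
        Set.disjoint_left]
      intro v hv hv'
      have := h2 v hv
      simp only [SimpleGraph.subgraphOfAdj_verts, Set.mem_insert_iff, Set.mem_singleton_iff] at hv'
      rcases hv' with rfl | rfl <;> simp_all
    · intro v hv
      simp only [SimpleGraph.Subgraph.verts_sup, SimpleGraph.subgraphOfAdj_verts, Set.mem_union,
        Set.mem_insert_iff, Set.mem_singleton_iff] at hv
      rcases hv with hv | rfl | rfl
      exacts [by simp [h2 v hv], by simp, by simp]
    · refine h3.anti fun v hv => ?_
      simp only [SimpleGraph.Subgraph.verts_sup, SimpleGraph.subgraphOfAdj_verts, Set.mem_union,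
        Set.mem_insert_iff, Set.mem_singleton_iff, Set.mem_ofPred_eq, List.mem_cons] at hv ⊢
      tauto

lemma SpanningPath.hasNearPerfectMatching {K : Set V}
    (h : SpanningPath G Set.univ K) : HasNearPerfectMatching G := by
  classical
  obtain ⟨l, -, h2, h3, h4, -⟩ := h
  obtain ⟨M, h5, -, h6⟩ := exists_isMatching_of_isChain l h2 h3
  refine ⟨M, h5, h6.anti fun v hv => ⟨(h4 v).mpr trivial, hv⟩⟩

end Paths

/-! ### Points placed at the nodes of a forest of binary trees

The nodes are pairs `(i, k)` of a level `i`, counted from the bottom, and a position `k`. The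
children of the node `(i + 1, k)` are `(i, 2 * k)` and `(i, 2 * k + 1)`. -/

/-- A bound for the number of paths that are needed to cover the points in the tree below the
node `(i, k)`, when `X` counts the points at each node. -/
def pathNumber (X : ℕ × ℕ → ℕ) : ℕ → ℕ → ℕ
  | 0, _ => 1
  | i + 1, k => max 1 (pathNumber X i (2 * k) + pathNumber X i (2 * k + 1) - X (i + 1, k))

lemma pathNumber_pos (X : ℕ × ℕ → ℕ) (i k : ℕ) : 0 < pathNumber X i k := by
  cases i with
  | zero => exact Nat.one_pos
  | succ i => exact lt_of_lt_of_le Nat.one_pos (le_max_left _ _)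

/-- The nodes of the tree below `(i, k)`, including `(i, k)` itself. -/
def subtree (i k : ℕ) : Set (ℕ × ℕ) :=
  {t | t.1 ≤ i ∧ t.2 / 2 ^ (i - t.1) = k}

lemma subtree_zero (k : ℕ) : subtree 0 k = {(0, k)} := by
  ext ⟨a, b⟩
  simp only [subtree, nonpos_iff_eq_zero, Set.mem_ofPred_eq, Set.mem_singleton_iff, Prod.mk.injEq]
  refine and_congr_right fun h => ?_
  simp [h]

lemma subtree_succ (i k : ℕ) :
    subtree (i + 1) k = subtree i (2 * k) ∪ subtree i (2 * k + 1) ∪ {(i + 1, k)} := by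
  ext ⟨a, b⟩
  simp only [subtree, Set.mem_ofPred_eq, Set.mem_union, Set.mem_singleton_iff, Prod.mk.injEq]
  rcases Nat.lt_or_ge i a with h | h
  · rcases eq_or_ne a (i + 1) with rfl | h'
    · simp
    · omega
  · rw [Nat.sub_add_comm h, pow_succ, ← Nat.div_div_eq_div_mul]
    omega

lemma disjoint_subtree (i : ℕ) {k l : ℕ} (h : k ≠ l) : Disjoint (subtree i k) (subtree i l) := by
  rw [Set.disjoint_left]
  rintro t ⟨-, h1⟩ ⟨-, h2⟩
  exact h (h1.symm.trans h2)

lemma top_notMem_subtree (i k l : ℕ) : (i + 1, k) ∉ subtree i l := by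
  simp [subtree]

section Tree

variable {V : Type*} {G : SimpleGraph V}

/-- The number of points at a node. -/
def nodeCount {ι : Type*} [DecidableEq ι] [Fintype V] (τ : V → ι) (t : ι) : ℕ :=
  (Finset.univ.filter fun v => τ v = t).card

lemma adj_of_mem_subtree {τ : V → ℕ × ℕ}
    (hadj : ∀ v w, v ≠ w → τ v ∈ subtree (τ w).1 (τ w).2 → G.Adj v w) {i k : ℕ} {v w : V}
    (hw : τ w = (i, k)) (hv : τ v ∈ subtree i k) (h : w ≠ v) : G.Adj w v :=
  (hadj v w h.symm (by rwa [hw])).symm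

lemma self_mem_subtree (i k : ℕ) : (i, k) ∈ subtree i k := by simp [subtree]

variable [Fintype V]

/-- If points at a node are adjacent to all points at and below this node, then the points in a
tree can be covered by as many paths as `pathNumber` says. -/
lemma pathCover_subtree {τ : V → ℕ × ℕ}
    (hadj : ∀ v w, v ≠ w → τ v ∈ subtree (τ w).1 (τ w).2 → G.Adj v w) (i k : ℕ) :
    PathCover G (τ ⁻¹' subtree i k) (pathNumber (nodeCount τ) i k) := by
  have hempty : PathCover G (∅ : Set V) 1 := ⟨[], by simp, by simp, by simp, by simp⟩
  induction i generalizing k with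
  | zero =>
    have := hempty.union_finset (Finset.univ.filter fun v => τ v = (0, k)) (by simp) (by
      intro x hx a ha hne
      simp only [Finset.mem_filter, Finset.mem_univ, true_and, Set.mem_empty_iff_false,
        false_or] at hx ha
      refine adj_of_mem_subtree hadj hx ?_ hne
      rw [ha]
      exact self_mem_subtree 0 k)
    rw [pathNumber]
    convert this.mono (e := 1) (by omega) using 1
    ext v
    simp [subtree_zero]
  | succ i ih =>
    have h1 := (ih (2 * k)).union (ih (2 * k + 1))
      ((disjoint_subtree i (by omega)).preimage τ)
    have h2 := h1.union_finset (Finset.univ.filter fun v => τ v = (i + 1, k)) (by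
      intro x hx
      simp only [Finset.mem_filter, Finset.mem_univ, true_and] at hx
      simp [hx, top_notMem_subtree]) (by
      intro x hx a ha hne
      simp only [Finset.mem_filter, Finset.mem_univ, true_and] at hx ha
      refine adj_of_mem_subtree hadj hx ?_ hne
      rw [subtree_succ]
      rcases ha with ha | ha
      · exact Or.inl ha
      · exact Or.inr ha)
    rw [pathNumber, nodeCount]
    convert h2 using 1
    ext v
    simp [subtree_succ, or_comm]

lemma spanningPath_subtree {τ : V → ℕ × ℕ}
    (hadj : ∀ v w, v ≠ w → τ v ∈ subtree (τ w).1 (τ w).2 → G.Adj v w) (i k : ℕ)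
    (h : pathNumber (nodeCount τ) i (2 * k) + pathNumber (nodeCount τ) i (2 * k + 1) <
      nodeCount τ (i + 1, k)) :
    SpanningPath G (τ ⁻¹' subtree (i + 1) k) {v | τ v = (i + 1, k)} := by
  have h1 := (pathCover_subtree hadj i (2 * k)).union (pathCover_subtree hadj i (2 * k + 1))
      ((disjoint_subtree i (by omega)).preimage τ)
  have h2 := h1.spanningPath (Finset.univ.filter fun v => τ v = (i + 1, k)) h (by
      intro x hx
      simp only [Finset.mem_filter, Finset.mem_univ, true_and] at hx
      simp [hx, top_notMem_subtree]) (by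
      intro x hx a ha hne
      simp only [Finset.mem_filter, Finset.mem_univ, true_and] at hx ha
      refine adj_of_mem_subtree hadj hx ?_ hne
      rw [subtree_succ]
      rcases ha with ha | ha
      · exact Or.inl ha
      · exact Or.inr ha)
  convert h2 using 1
  · ext v
    simp [subtree_succ, or_comm]
  · ext v
    simp

/-- A forest whose top nodes are crowded, and whose points at the top nodes form a clique, has
a spanning path with ends at the top. -/
lemma spanningPath_forest {τ : V → ℕ × ℕ}
    (hadj : ∀ v w, v ≠ w → τ v ∈ subtree (τ w).1 (τ w).2 → G.Adj v w) (i N : ℕ) (hN : 0 < N)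
    (hclique : G.IsClique {v | (τ v).1 = i + 1})
    (hτ : ∀ v, ∃ k < N, τ v ∈ subtree (i + 1) k)
    (h : ∀ k < N, pathNumber (nodeCount τ) i (2 * k) + pathNumber (nodeCount τ) i (2 * k + 1) <
      nodeCount τ (i + 1, k)) :
    SpanningPath G Set.univ {v | (τ v).1 = i + 1} := by
  have key : ∀ n < N, SpanningPath G {v | ∃ k ≤ n, τ v ∈ subtree (i + 1) k}
      {v | (τ v).1 = i + 1} := by
    intro n hn
    have hs : SpanningPath G (τ ⁻¹' subtree (i + 1) n) {v | (τ v).1 = i + 1} :=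
      (spanningPath_subtree hadj i n (h n hn)).mono fun v hv => by
        rw [Set.mem_ofPred_eq] at *
        rw [hv]
    induction n with
    | zero =>
      convert hs using 1
      ext v
      simp
    | succ n ih =>
      have hs' : SpanningPath G (τ ⁻¹' subtree (i + 1) n) {v | (τ v).1 = i + 1} :=
        (spanningPath_subtree hadj i n (h n (by omega))).mono fun v hv => by
          rw [Set.mem_ofPred_eq] at *
          rw [hv]
      have hu := (ih (by omega) hs').union hs (by
        rw [Set.disjoint_left]
        rintro v ⟨k, hk, hv⟩ hv'
        exact Set.disjoint_left.mp (disjoint_subtree (i + 1) (by omega : k ≠ n + 1)) hv hv')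
        hclique
      convert hu using 1
      ext v
      simp only [Set.mem_ofPred_eq, Set.mem_union, Set.mem_preimage]
      constructor
      · rintro ⟨k, hk, hv⟩
        rcases Nat.lt_or_ge n k with h' | h'
        · obtain rfl : k = n + 1 := by omega
          exact Or.inr hv
        · exact Or.inl ⟨k, h', hv⟩
      · rintro (⟨k, hk, hv⟩ | hv)
        exacts [⟨k, by omega, hv⟩, ⟨n + 1, le_rfl, hv⟩]
  convert key (N - 1) (by omega) using 1
  ext v
  obtain ⟨k, hk, hv⟩ := hτ v
  simp only [Set.mem_univ, Set.mem_ofPred_eq, true_iff]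
  exact ⟨k, by omega, hv⟩

lemma hasHamiltonCycle_of_forest [DecidableEq V] {τ : V → ℕ × ℕ}
    (hadj : ∀ v w, v ≠ w → τ v ∈ subtree (τ w).1 (τ w).2 → G.Adj v w) (i N : ℕ) (hN : 0 < N)
    (hclique : G.IsClique {v | (τ v).1 = i + 1})
    (hτ : ∀ v, ∃ k < N, τ v ∈ subtree (i + 1) k)
    (h : ∀ k < N, pathNumber (nodeCount τ) i (2 * k) + pathNumber (nodeCount τ) i (2 * k + 1) <
      nodeCount τ (i + 1, k)) :
    HasHamiltonCycle G ∧ HasNearPerfectMatching G := by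
  have hs := spanningPath_forest hadj i N hN hclique hτ h
  refine ⟨hs.hasHamiltonCycle hclique ?_, hs.hasNearPerfectMatching⟩
  -- The two path numbers below the first top node are positive, so this node alone holds at least
  -- three points.
  have h0 := h 0 hN
  have h1 := pathNumber_pos (nodeCount τ) i (2 * 0)
  have h2 := pathNumber_pos (nodeCount τ) i (2 * 0 + 1)
  have h3 : nodeCount τ (i + 1, 0) ≤ Fintype.card V := Finset.card_le_univ _
  omega

end Tree

/-! ### Thinning of a Poisson process -/

section Thinning

variable {E : Type*} {ι : Type*} [DecidableEq ι]

lemma nodeCount_succ (τ : E → ι) (x : ℕ → E) (m : ℕ) (t : ι) :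
    nodeCount (fun j : Fin (m + 1) => τ (x j)) t =
      nodeCount (fun j : Fin m => τ (x j)) t + if τ (x m) = t then 1 else 0 := by
  simp only [nodeCount, Finset.card_filter, Fin.sum_univ_castSucc, Fin.val_castSucc, Fin.val_last]

lemma sum_nodeCount [Fintype ι] {V : Type*} [Fintype V] (τ : V → ι) :
    ∑ t, nodeCount τ t = Fintype.card V := by
  simp only [nodeCount]
  rw [← Finset.card_eq_sum_card_fiberwise (f := τ) (s := Finset.univ) (t := Finset.univ)
    (by simp)]
  rfl

lemma nodeCount_comp_some {s : Finset ι} {V : Type*} [Fintype V] (τ : V → ι) (t : s) :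
    nodeCount (fun v => if h : τ v ∈ s then some (⟨τ v, h⟩ : s) else none) (some t) =
      nodeCount τ t := by
  simp only [nodeCount]
  congr 1
  ext v
  simp only [Finset.mem_filter, Finset.mem_univ, true_and]
  constructor
  · intro h
    split_ifs at h with h'
    simp only [Option.some.injEq] at h
    rw [← h]
  · intro h
    have : τ v ∈ s := h ▸ t.2
    simp [h]

variable [MeasurableSpace E] [MeasurableSpace ι] [MeasurableSingletonClass ι]

lemma measurable_nodeCount_of_forall {V : Type*} [Fintype V] {f : E → V → ι}
    (hf : ∀ v, Measurable fun x => f x v) (t : ι) : Measurable fun x => nodeCount (f x) t := by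
  simp only [nodeCount, Finset.card_filter]
  exact Finset.measurable_sum _ fun v _ =>
    Measurable.ite (hf v (measurableSet_singleton t)) measurable_const measurable_const

lemma measurable_nodeCount_fin {τ : E → ι} (hτ : Measurable τ) (m : ℕ) (t : ι) :
    Measurable fun x : ℕ → E => nodeCount (fun j : Fin m => τ (x j)) t :=
  measurable_nodeCount_of_forall (f := fun (x : ℕ → E) (j : Fin m) => τ (x j))
    (fun j => hτ.comp (measurable_pi_apply (j : ℕ))) t

lemma measurable_nodeCount {τ : E → ι} (hτ : Measurable τ) (t : ι) :
    Measurable fun ω : ℕ × (ℕ → E) => nodeCount (fun j : Fin ω.1 => τ (ω.2 j)) t :=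
  measurable_from_prod_countable_right fun m => measurable_nodeCount_fin hτ m t

/-- The multinomial law of the numbers of points of each type among `m` independent points. -/
lemma infinitePi_real_nodeCount [Fintype ι] (Q : Measure E) [IsProbabilityMeasure Q]
    {τ : E → ι} (hτ : Measurable τ) (m : ℕ) (k : ι → ℕ) :
    (Measure.infinitePi fun _ : ℕ => Q).real
        {x | ∀ t, nodeCount (fun j : Fin m => τ (x j)) t = k t} =
      if ∑ t, k t = m then
        m.factorial * ∏ t, Q.real (τ ⁻¹' {t}) ^ k t / (k t).factorial else 0 := by
  induction m generalizing k with
  | zero =>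
    simp only [Finset.sum_eq_zero_iff, Finset.mem_univ, true_imp_iff]
    split_ifs with h
    · have : ∀ t, k t = 0 := h
      simp [nodeCount, this]
    · push Not at h
      obtain ⟨t, ht⟩ := h
      have : {x : ℕ → E | ∀ t, nodeCount (fun j : Fin 0 => τ (x j)) t = k t} = ∅ := by
        ext x
        simp only [Set.mem_ofPred_eq, Set.mem_empty_iff_false, iff_false, not_forall]
        exact ⟨t, by simpa [nodeCount] using ht.symm⟩
      rw [this, measureReal_empty]
  | succ m ih =>
    set P := Measure.infinitePi fun _ : ℕ => Q with hP
    have hind : iIndepFun (fun (i : ℕ) (x : ℕ → E) => τ (x i)) P :=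
      iIndepFun_infinitePi (P := fun _ : ℕ => Q) (X := fun _ => τ) (fun _ => hτ)
    -- If the last point has type `t`, the other `m` points have counts `k` with `k t` lowered by
    -- one. The induction hypothesis and the factor for the last point give `k t` times an
    -- expression that does not depend on `t`, and summing over `t` turns `m !` into `(m + 1)!`.
    have hstep : ∀ t, P.real ({x | τ (x m) = t} ∩
        {x | ∀ s, nodeCount (fun j : Fin (m + 1) => τ (x j)) s = k s}) =
        if ∑ t, k t = m + 1 then k t * (m.factorial *
          ∏ s, Q.real (τ ⁻¹' {s}) ^ k s / (k s).factorial) else 0 := by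
      intro t
      rcases Nat.eq_zero_or_pos (k t) with h0 | h0
      · have : ({x | τ (x m) = t} ∩
            {x | ∀ s, nodeCount (fun j : Fin (m + 1) => τ (x j)) s = k s} : Set (ℕ → E)) = ∅ := by
          ext x
          simp only [Set.mem_inter_iff, Set.mem_ofPred_eq, Set.mem_empty_iff_false, iff_false,
            not_and, not_forall]
          intro hx
          refine ⟨t, ?_⟩
          rw [nodeCount_succ, if_pos hx, h0]
          omega
        rw [this, measureReal_empty, h0]
        simp
      · set k' := Function.update k t (k t - 1) with hk'
        have hset : ({x | τ (x m) = t} ∩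
            {x | ∀ s, nodeCount (fun j : Fin (m + 1) => τ (x j)) s = k s} : Set (ℕ → E)) =
            {x | τ (x m) = t} ∩ {x | ∀ s, nodeCount (fun j : Fin m => τ (x j)) s = k' s} := by
          ext x
          simp only [Set.mem_inter_iff, Set.mem_ofPred_eq]
          refine and_congr_right fun hx => forall_congr' fun s => ?_
          rw [nodeCount_succ, hx, hk']
          rcases eq_or_ne t s with rfl | hs
          · simp only [if_true, Function.update_self]
            omega
          · simp [hs, Function.update_of_ne hs.symm]
        -- The type of point `m` and the counts of the first `m` points are functions of disjoint
        -- families of coordinates, hence independent.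
        have hφ : Measurable fun w : ({m} : Finset ℕ) → ι => w ⟨m, by simp⟩ :=
          measurable_pi_apply _
        have hψ : Measurable fun (w : Finset.range m → ι) (s : ι) =>
            nodeCount (fun j : Fin m => w ⟨j, by simp⟩) s :=
          measurable_pi_lambda _ fun s => measurable_nodeCount_of_forall
            (f := fun (w : Finset.range m → ι) (j : Fin m) => w ⟨j, by simp⟩)
            (fun j => measurable_pi_apply _) s
        have hI := (hind.indepFun_finset {m} (Finset.range m) (by simp)
          (fun i => hτ.comp (measurable_pi_apply i))).comp hφ hψ
        have hmul := hI.measure_inter_preimage_eq_mul {t} {k'} (measurableSet_singleton t)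
          (measurableSet_singleton k')
        have e1 : ((fun w : ({m} : Finset ℕ) → ι => w ⟨m, by simp⟩) ∘
            (fun (a : ℕ → E) (i : ({m} : Finset ℕ)) => τ (a i))) ⁻¹' {t} = {x | τ (x m) = t} := by
          ext x
          simp
        have e2 : ((fun (w : Finset.range m → ι) (s : ι) =>
              nodeCount (fun j : Fin m => w ⟨j, by simp⟩) s) ∘
            (fun (a : ℕ → E) (i : Finset.range m) => τ (a i))) ⁻¹' {k'} =
            {x | ∀ s, nodeCount (fun j : Fin m => τ (x j)) s = k' s} := by
          ext x
          simp [funext_iff]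
        rw [e1, e2] at hmul
        have e3 : P {x | τ (x m) = t} = Q (τ ⁻¹' {t}) := by
          have := (measurePreserving_eval_infinitePi (fun _ : ℕ => Q) m).measure_preimage
            (hτ (measurableSet_singleton t)).nullMeasurableSet
          exact this
        rw [hset, measureReal_def, hmul, ENNReal.toReal_mul, e3, ← measureReal_def,
          ← measureReal_def, ih]
        have hsum : ∑ s, k s = ∑ s, k' s + 1 := by
          rw [← Finset.add_sum_erase _ _ (Finset.mem_univ t),
            ← Finset.add_sum_erase _ k' (Finset.mem_univ t)]
          have : ∑ s ∈ Finset.univ.erase t, k s = ∑ s ∈ Finset.univ.erase t, k' s :=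
            Finset.sum_congr rfl fun s hs => by
              rw [hk', Function.update_of_ne (Finset.ne_of_mem_erase hs)]
          rw [this, hk', Function.update_self]
          omega
        rw [hsum]
        simp only [add_left_inj]
        split_ifs with h
        · rw [← Finset.mul_prod_erase _ _ (Finset.mem_univ t),
            ← Finset.mul_prod_erase _ (fun s => Q.real (τ ⁻¹' {s}) ^ k s / ((k s).factorial : ℝ))
              (Finset.mem_univ t)]
          have : ∏ s ∈ Finset.univ.erase t, Q.real (τ ⁻¹' {s}) ^ k s / ((k s).factorial : ℝ) =
              ∏ s ∈ Finset.univ.erase t, Q.real (τ ⁻¹' {s}) ^ k' s / ((k' s).factorial : ℝ) :=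
            Finset.prod_congr rfl fun s hs => by
              rw [hk', Function.update_of_ne (Finset.ne_of_mem_erase hs)]
          rw [this, hk', Function.update_self]
          obtain ⟨j, hj⟩ : ∃ j, k t = j + 1 := ⟨k t - 1, by omega⟩
          rw [hj, Nat.add_sub_cancel, Nat.factorial_succ, pow_succ]
          have hj' : (j.factorial : ℝ) ≠ 0 := by positivity
          have hj'' : ((j : ℝ) + 1) ≠ 0 := by positivity
          push_cast
          field_simp
        · simp
    have hU : P.real {x | ∀ s, nodeCount (fun j : Fin (m + 1) => τ (x j)) s = k s} =
        ∑ t, P.real ({x | τ (x m) = t} ∩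
          {x | ∀ s, nodeCount (fun j : Fin (m + 1) => τ (x j)) s = k s}) := by
      have hmeas : MeasurableSet
          {x : ℕ → E | ∀ s, nodeCount (fun j : Fin (m + 1) => τ (x j)) s = k s} := by
        have : {x : ℕ → E | ∀ s, nodeCount (fun j : Fin (m + 1) => τ (x j)) s = k s} =
            ⋂ s, (fun x => nodeCount (fun j : Fin (m + 1) => τ (x j)) s) ⁻¹' {k s} := by
          ext x
          simp
        rw [this]
        exact MeasurableSet.iInter fun s =>
          measurable_nodeCount_fin hτ (m + 1) s (measurableSet_singleton _)
      rw [← measureReal_iUnion_fintype]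
      · congr 1
        ext x
        simp
      · intro a b hab
        rw [Function.onFun, Set.disjoint_left]
        rintro x ⟨h1, -⟩ ⟨h2, -⟩
        exact hab (h1.symm.trans h2)
      · intro t
        exact ((hτ.comp (measurable_pi_apply m)) (measurableSet_singleton t)).inter hmeas
    rw [hU]
    simp only [hstep]
    split_ifs with h
    · rw [← Finset.sum_mul, ← Nat.cast_sum, h, Nat.factorial_succ]
      push_cast
      ring
    · simp

/-- With K = ∑ k t, the Poisson weight e^(-r) r^K / K! cancels the factor K! of the multinomial law.
As the type probabilities sum to 1, both r^K and e^(-r) split into one factor for each type. -/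
lemma map_nodeCount_eq_pi [Fintype ι] (Q : Measure E) [IsProbabilityMeasure Q] (r : ℝ≥0)
    {τ : E → ι} (hτ : Measurable τ) :
    ((poissonMeasure r).prod (Measure.infinitePi fun _ : ℕ => Q)).map
        (fun ω t => nodeCount (fun j : Fin ω.1 => τ (ω.2 j)) t) =
      Measure.pi fun t => poissonMeasure (r * (Q (τ ⁻¹' {t})).toNNReal) := by
  have hmeas : Measurable fun (ω : ℕ × (ℕ → E)) t => nodeCount (fun j : Fin ω.1 => τ (ω.2 j)) t :=
    measurable_pi_lambda _ fun t => measurable_nodeCount hτ t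
  have := Measure.isProbabilityMeasure_map (μ := (poissonMeasure r).prod
    (Measure.infinitePi fun _ : ℕ => Q)) hmeas.aemeasurable
  refine Measure.ext_of_singleton fun k => ?_
  rw [Measure.pi_singleton, Measure.map_apply hmeas (measurableSet_singleton k)]
  have hset : (fun (ω : ℕ × (ℕ → E)) t => nodeCount (fun j : Fin ω.1 => τ (ω.2 j)) t) ⁻¹' {k} =
      {∑ t, k t} ×ˢ
        {x | ∀ t, nodeCount (fun j : Fin (∑ t, k t) => τ (x j)) t = k t} := by
    ext ⟨m, x⟩
    simp only [Set.mem_preimage, Set.mem_singleton_iff, funext_iff, Set.mem_prod,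
      Set.mem_ofPred_eq]
    constructor
    · intro h
      have hm : m = ∑ t, k t := by
        rw [← Finset.sum_congr rfl fun t _ => h t, sum_nodeCount, Fintype.card_fin]
      subst hm
      exact ⟨rfl, h⟩
    · rintro ⟨rfl, h⟩
      exact h
  rw [hset, Measure.prod_prod, ← ofReal_measureReal (μ := Measure.infinitePi _),
    infinitePi_real_nodeCount Q hτ, if_pos rfl, poissonMeasure_singleton]
  simp only [poissonMeasure_singleton]
  rw [← ENNReal.ofReal_mul (by positivity), ← ENNReal.ofReal_prod_of_nonneg
    (fun _ _ => by positivity)]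
  congr 1
  have hq : ∑ t, Q.real (τ ⁻¹' {t}) = 1 := by
    rw [← measureReal_iUnion_fintype]
    · rw [← Set.preimage_iUnion, Set.iUnion_of_singleton, Set.preimage_univ, probReal_univ]
    · intro a b hab
      exact (Set.disjoint_singleton.mpr hab).preimage τ
    · exact fun t => hτ (measurableSet_singleton t)
  have hq' : ∀ t, ((Q (τ ⁻¹' {t})).toNNReal : ℝ) = Q.real (τ ⁻¹' {t}) := fun t => rfl
  simp only [NNReal.coe_mul, hq', mul_pow, mul_div_assoc, Finset.prod_mul_distrib,
    ← Real.exp_sum, Finset.prod_pow_eq_pow_sum]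
  rw [Finset.sum_neg_distrib, ← Finset.mul_sum, hq, mul_one]
  have : ((∑ t, k t).factorial : ℝ) ≠ 0 := by positivity
  field_simp

/-- The numbers of points of different types in a Poisson process are independent Poisson
variables. -/
theorem poisson_thinning [Countable ι] (Q : Measure E) [IsProbabilityMeasure Q] (r : ℝ≥0)
    {τ : E → ι} (hτ : Measurable τ) :
    iIndepFun (fun t (ω : ℕ × (ℕ → E)) => nodeCount (fun j : Fin ω.1 => τ (ω.2 j)) t)
        ((poissonMeasure r).prod (Measure.infinitePi fun _ : ℕ => Q)) ∧
      ∀ t, ((poissonMeasure r).prod (Measure.infinitePi fun _ : ℕ => Q)).map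
          (fun ω => nodeCount (fun j : Fin ω.1 => τ (ω.2 j)) t) =
        poissonMeasure (r * (Q (τ ⁻¹' {t})).toNNReal) := by
  set P := (poissonMeasure r).prod (Measure.infinitePi fun _ : ℕ => Q) with hP
  -- Independence only concerns finite sets `s` of types. All types outside `s` are merged into
  -- `none`, which reduces the claim to finitely many types.
  let _ : ∀ s : Finset ι, MeasurableSpace (Option s) := fun _ => ⊤
  have hσ : ∀ s : Finset ι, Measurable fun e : E =>
      if h : τ e ∈ s then some (⟨τ e, h⟩ : s) else none := by
    intro s
    exact (measurable_of_countable fun t : ι => if h : t ∈ s then some (⟨t, h⟩ : s) else none).comp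
      hτ
  have hlaw : ∀ s : Finset ι, P.map (fun ω (t : Option s) => nodeCount (fun j : Fin ω.1 =>
      if h : τ (ω.2 j) ∈ s then some (⟨τ (ω.2 j), h⟩ : s) else none) t) = _ :=
    fun s => map_nodeCount_eq_pi Q r (hσ s)
  have hmarg : ∀ (s : Finset ι) (t : Option s), P.map (fun ω => nodeCount (fun j : Fin ω.1 =>
      if h : τ (ω.2 j) ∈ s then some (⟨τ (ω.2 j), h⟩ : s) else none) t) =
      poissonMeasure (r * (Q ((fun e : E =>
      if h : τ e ∈ s then some (⟨τ e, h⟩ : s) else none) ⁻¹' {t})).toNNReal) := by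
    intro s t
    have h1 := congrArg (Measure.map fun w : Option s → ℕ => w t) (hlaw s)
    rw [Measure.map_map (measurable_pi_apply t)
      (measurable_pi_lambda _ fun t => measurable_nodeCount (hσ s) t)] at h1
    exact h1.trans (measurePreserving_eval _ t).map_eq
  constructor
  · rw [iIndepFun_iff_finset]
    intro s
    have h1 : iIndepFun (fun (t : Option s) (ω : ℕ × (ℕ → E)) => nodeCount (fun j : Fin ω.1 =>
        if h : τ (ω.2 j) ∈ s then some (⟨τ (ω.2 j), h⟩ : s) else none) t) P := by
      rw [iIndepFun_iff_map_fun_eq_pi_map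
        (fun t => (measurable_nodeCount (hσ s) t).aemeasurable), hlaw s]
      simp only [hmarg s]
    have h2 := h1.precomp (Option.some_injective s)
    convert h2 using 1
    funext t ω
    exact (nodeCount_comp_some (fun j : Fin ω.1 => τ (ω.2 j)) t).symm
  · intro t
    have h1 := hmarg {t} (some ⟨t, by simp⟩)
    convert h1 using 3
    · rename_i ω
      exact (nodeCount_comp_some (s := {t}) (fun j : Fin ω.1 => τ (ω.2 j)) ⟨t, by simp⟩).symm
    · congr 2
      ext e
      by_cases h : τ e = t <;> simp [h]

/-- This is the probability generating function exp(r (z - 1)) at z = 1/2. -/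
lemma lintegral_half_pow_poissonMeasure (r : ℝ≥0) :
    ∫⁻ k, (2⁻¹ : ℝ≥0∞) ^ k ∂(poissonMeasure r) = ENNReal.ofReal (Real.exp (-(r / 2))) := by
  have h := (NormedSpace.expSeries_div_hasSum_exp ((r : ℝ) / 2)).mul_left (Real.exp (-r))
  rw [← Real.exp_eq_exp_ℝ, ← Real.exp_add] at h
  rw [lintegral_countable']
  have e : ∀ k : ℕ, (2⁻¹ : ℝ≥0∞) ^ k * (poissonMeasure r) {k} =
      ENNReal.ofReal (Real.exp (-r) * (((r : ℝ) / 2) ^ k / k.factorial)) := by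
    intro k
    rw [poissonMeasure_singleton, show (2⁻¹ : ℝ≥0∞) = ENNReal.ofReal (2⁻¹) by
      rw [ENNReal.ofReal_inv_of_pos two_pos]; simp, ← ENNReal.ofReal_pow (by positivity),
      ← ENNReal.ofReal_mul (by positivity)]
    congr 1
    rw [div_pow, inv_pow]
    field_simp
  simp only [e]
  rw [← ENNReal.ofReal_tsum_of_nonneg (fun k => by positivity) h.summable, h.tsum_eq]
  congr 2
  ring

end Thinning

/-! ### The number of paths when the counts are independent -/

section Moments

variable {Ω : Type*} {X : ℕ × ℕ → Ω → ℕ}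

/-- The `σ`-algebra that is generated by the counts at the nodes in `S`. -/
@[reducible] def countAlgebra (X : ℕ × ℕ → Ω → ℕ) (S : Set (ℕ × ℕ)) : MeasurableSpace Ω :=
  ⨆ t ∈ S, MeasurableSpace.comap (X t) ⊤

lemma countAlgebra_mono {S T : Set (ℕ × ℕ)} (h : S ⊆ T) :
    countAlgebra X S ≤ countAlgebra X T :=
  biSup_mono h

lemma measurable_countAlgebra {S : Set (ℕ × ℕ)} {t : ℕ × ℕ} (ht : t ∈ S) :
    Measurable[countAlgebra X S] (X t) :=
  (comap_measurable (X t)).mono (le_biSup (fun t => MeasurableSpace.comap (X t) ⊤) ht) le_rfl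

/-- Measurability with respect to the counts of the own subtree is what makes path numbers of
disjoint subtrees independent. -/
lemma measurable_pathNumber (i k : ℕ) :
    Measurable[countAlgebra X (subtree i k)] fun ω => pathNumber (fun t => X t ω) i k := by
  induction i generalizing k with
  | zero => exact measurable_const
  | succ i ih =>
    have h1 := (ih (2 * k)).mono (countAlgebra_mono (X := X) (T := subtree (i + 1) k)
      (by rw [subtree_succ]; exact fun t ht => Or.inl (Or.inl ht))) le_rfl
    have h2 := (ih (2 * k + 1)).mono (countAlgebra_mono (X := X) (T := subtree (i + 1) k)
      (by rw [subtree_succ]; exact fun t ht => Or.inl (Or.inr ht))) le_rfl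
    have h3 := measurable_countAlgebra (X := X) (self_mem_subtree (i + 1) k)
    exact measurable_const.max ((h1.add h2).sub h3)

variable [MeasurableSpace Ω] {P : Measure Ω}

lemma countAlgebra_le (hX : ∀ t, Measurable (X t)) (S : Set (ℕ × ℕ)) :
    countAlgebra X S ≤ ‹MeasurableSpace Ω› :=
  iSup₂_le fun t _ => (hX t).comap_le

lemma lintegral_mul_of_disjoint (hX : ∀ t, Measurable (X t)) (hind : iIndepFun X P)
    {S T : Set (ℕ × ℕ)} (hST : Disjoint S T) {f g : Ω → ℝ≥0∞}
    (hf : Measurable[countAlgebra X S] f) (hg : Measurable[countAlgebra X T] g) :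
    ∫⁻ ω, f ω * g ω ∂P = (∫⁻ ω, f ω ∂P) * ∫⁻ ω, g ω ∂P :=
  lintegral_mul_eq_lintegral_mul_lintegral_of_independent_measurableSpace
    (countAlgebra_le hX S) (countAlgebra_le hX T)
    (indep_iSup_of_disjoint (fun t => (hX t).comap_le) hind.iIndep hST) hf hg

lemma two_pow_add_mul_inv_pow (b c : ℕ) : (2 : ℝ≥0∞) ^ (b + c) * 2⁻¹ ^ b = 2 ^ c := by
  rw [pow_add, mul_comm, ← mul_assoc, ← mul_pow, ENNReal.inv_mul_cancel (by simp) (by simp),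
    one_pow, one_mul]

/-- Bounding the maximum by a sum turns the recursion for `pathNumber` into an expression that
factorises under independence. -/
lemma two_pow_max_sub_le (a b : ℕ) :
    (2 : ℝ≥0∞) ^ max 1 (a - b) ≤ 2 + 2 ^ a * 2⁻¹ ^ b := by
  rcases Nat.lt_or_ge b a with h | h
  · obtain ⟨c, rfl⟩ := Nat.exists_eq_add_of_le h.le
    rw [max_eq_right (by omega), Nat.add_sub_cancel_left, two_pow_add_mul_inv_pow]
    exact le_add_self
  · rw [Nat.sub_eq_zero_of_le h]
    simp

lemma one_le_two_pow_mul {a b : ℕ} (h : b ≤ a) : (1 : ℝ≥0∞) ≤ 2 ^ a * 2⁻¹ ^ b := by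
  obtain ⟨c, rfl⟩ := Nat.exists_eq_add_of_le h
  rw [two_pow_add_mul_inv_pow]
  exact one_le_pow₀ (by norm_num)

/-- The two subtrees below a node and the node itself are disjoint sets of nodes, so the three
factors are independent. -/
lemma lintegral_children (hX : ∀ t, Measurable (X t)) (hind : iIndepFun X P) (i k : ℕ) :
    ∫⁻ ω, 2 ^ (pathNumber (fun t => X t ω) i (2 * k) + pathNumber (fun t => X t ω) i (2 * k + 1)) *
        2⁻¹ ^ X (i + 1, k) ω ∂P =
      (∫⁻ ω, 2 ^ pathNumber (fun t => X t ω) i (2 * k) ∂P) *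
        (∫⁻ ω, 2 ^ pathNumber (fun t => X t ω) i (2 * k + 1) ∂P) *
          ∫⁻ ω, 2⁻¹ ^ X (i + 1, k) ω ∂P := by
  have hpow : ∀ c : ℝ≥0∞, Measurable fun n : ℕ => c ^ n := fun c => measurable_of_countable _
  have hp : ∀ l, Measurable[countAlgebra X (subtree i l)] fun ω =>
      (2 : ℝ≥0∞) ^ pathNumber (fun t => X t ω) i l := fun l =>
    (hpow 2).comp (measurable_pathNumber i l)
  have h1 := hp (2 * k)
  have h2 := hp (2 * k + 1)
  have h3 : Measurable[countAlgebra X {(i + 1, k)}] fun ω => (2⁻¹ : ℝ≥0∞) ^ X (i + 1, k) ω :=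
    (hpow 2⁻¹).comp (measurable_countAlgebra (Set.mem_singleton ((i + 1, k) : ℕ × ℕ)))
  rw [← lintegral_mul_of_disjoint hX hind (disjoint_subtree i (by omega)) h1 h2,
    ← lintegral_mul_of_disjoint hX hind
      (S := subtree i (2 * k) ∪ subtree i (2 * k + 1)) (T := {(i + 1, k)}) ?_ ?_ h3]
  · simp only [pow_add]
  · rw [Set.disjoint_singleton_right]
    rintro (h | h)
    exacts [top_notMem_subtree i k _ h, top_notMem_subtree i k _ h]
  · exact (h1.mono (countAlgebra_mono Set.subset_union_left) le_rfl).mul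
      (h2.mono (countAlgebra_mono Set.subset_union_right) le_rfl)

/-- The bound 4 reproduces itself: 2 + 4 · 4 · (1/8) = 4. Hence it does not deteriorate with the
height of the tree. -/
lemma lintegral_two_pow_pathNumber_le [IsProbabilityMeasure P] (hX : ∀ t, Measurable (X t))
    (hind : iIndepFun X P) (i k : ℕ)
    (hsmall : ∀ t ∈ subtree i k, ∫⁻ ω, 2⁻¹ ^ X t ω ∂P ≤ 8⁻¹) :
    ∫⁻ ω, 2 ^ pathNumber (fun t => X t ω) i k ∂P ≤ 4 := by
  induction i generalizing k with
  | zero =>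
    simp only [pathNumber, pow_one, lintegral_const, measure_univ, mul_one]
    norm_num
  | succ i ih =>
    have h1 := ih (2 * k) fun t ht => hsmall t (by rw [subtree_succ]; exact Or.inl (Or.inl ht))
    have h2 := ih (2 * k + 1) fun t ht => hsmall t (by rw [subtree_succ]; exact Or.inl (Or.inr ht))
    have h3 := hsmall _ (self_mem_subtree (i + 1) k)
    calc ∫⁻ ω, 2 ^ pathNumber (fun t => X t ω) (i + 1) k ∂P
        ≤ ∫⁻ ω, (2 + 2 ^ (pathNumber (fun t => X t ω) i (2 * k) +
            pathNumber (fun t => X t ω) i (2 * k + 1)) * 2⁻¹ ^ X (i + 1, k) ω) ∂P :=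
          lintegral_mono fun ω => two_pow_max_sub_le _ _
      _ = 2 + (∫⁻ ω, 2 ^ pathNumber (fun t => X t ω) i (2 * k) ∂P) *
          (∫⁻ ω, 2 ^ pathNumber (fun t => X t ω) i (2 * k + 1) ∂P) *
          ∫⁻ ω, 2⁻¹ ^ X (i + 1, k) ω ∂P := by
        rw [lintegral_add_left measurable_const, lintegral_children hX hind]
        simp
      _ ≤ 2 + 4 * 4 * 8⁻¹ := by gcongr
      _ = 4 := by
        rw [show (4 * 4 : ℝ≥0∞) = 2 * 8 by norm_num, mul_assoc,
          ENNReal.mul_inv_cancel (by simp) (by simp)]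
        norm_num

/-- A top node is unlikely not to have enough points for joining the paths below it. -/
lemma measure_le_pathNumber_le [IsProbabilityMeasure P] (hX : ∀ t, Measurable (X t))
    (hind : iIndepFun X P) (i k : ℕ)
    (hsmall : ∀ t ∈ subtree (i + 1) k, ∫⁻ ω, 2⁻¹ ^ X t ω ∂P ≤ 8⁻¹) :
    P {ω | X (i + 1, k) ω ≤ pathNumber (fun t => X t ω) i (2 * k) +
        pathNumber (fun t => X t ω) i (2 * k + 1)} ≤
      16 * ∫⁻ ω, 2⁻¹ ^ X (i + 1, k) ω ∂P := by
  have h1 := lintegral_two_pow_pathNumber_le hX hind i (2 * k) fun t ht =>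
    hsmall t (by rw [subtree_succ]; exact Or.inl (Or.inl ht))
  have h2 := lintegral_two_pow_pathNumber_le hX hind i (2 * k + 1) fun t ht =>
    hsmall t (by rw [subtree_succ]; exact Or.inl (Or.inr ht))
  have hm : ∀ k, Measurable fun ω => pathNumber (fun t => X t ω) i k := fun k =>
    (measurable_pathNumber i k).mono (countAlgebra_le hX _) le_rfl
  have hpow : ∀ c : ℝ≥0∞, Measurable fun n : ℕ => c ^ n := fun c => measurable_of_countable _
  -- Markov's inequality: on the event, two to the power of paths minus points is at least 1.
  calc _ ≤ ∫⁻ ω, 2 ^ (pathNumber (fun t => X t ω) i (2 * k) +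
            pathNumber (fun t => X t ω) i (2 * k + 1)) * 2⁻¹ ^ X (i + 1, k) ω ∂P :=
        meas_le_lintegral₀ (((hpow 2).comp ((hm _).add (hm _))).mul
          ((hpow 2⁻¹).comp (hX _))).aemeasurable fun ω hω => one_le_two_pow_mul hω
    _ ≤ 4 * 4 * ∫⁻ ω, 2⁻¹ ^ X (i + 1, k) ω ∂P := by
      rw [lintegral_children hX hind]
      gcongr
    _ = _ := by norm_num

end Moments

/-! ### Nodes of points of the hyperbolic disk -/

section Geometry

lemma dist_polarPoint_le_add {p q : ℝ × ℝ} (hp : 0 ≤ p.1) (hq : 0 ≤ q.1) :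
    dist (polarPoint p) (polarPoint q) ≤ p.1 + q.1 := by
  have h : Real.cosh (dist (polarPoint p) (polarPoint q)) ≤ Real.cosh (p.1 + q.1) := by
    rw [cosh_dist_polarPoint, Real.cosh_add]
    nlinarith [mul_nonneg (Real.sinh_nonneg_iff.mpr hp) (Real.sinh_nonneg_iff.mpr hq),
      Real.neg_one_le_cos (p.2 - q.2)]
  rwa [Real.cosh_le_cosh, abs_of_nonneg dist_nonneg, abs_of_nonneg (by positivity)] at h

/-- By cos δ ≥ 1 - δ²/2 the law of cosines bounds the hyperbolic cosine of the distance by cosh (p.1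
- q.1) plus a term that the hypothesis on the angles controls. No additive constant is lost in R. -/
lemma dist_polarPoint_le {p q : ℝ × ℝ} {R : ℝ} (hp : 0 ≤ p.1) (hq : 0 ≤ q.1) (hpR : p.1 ≤ R)
    (hqR : q.1 ≤ R) (h : (p.2 - q.2) ^ 2 ≤ Real.exp (R - p.1 - q.1)) :
    dist (polarPoint p) (polarPoint q) ≤ R := by
  have hcosh : Real.cosh (dist (polarPoint p) (polarPoint q)) ≤ Real.cosh R := by
    rw [cosh_dist_polarPoint]
    have h1 := Real.one_sub_sq_div_two_le_cos (x := p.2 - q.2)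
    have h2 := mul_nonneg (Real.sinh_nonneg_iff.mpr hp) (Real.sinh_nonneg_iff.mpr hq)
    have h3 : Real.cosh p.1 * Real.cosh q.1 -
        Real.sinh p.1 * Real.sinh q.1 * Real.cos (p.2 - q.2) ≤
        Real.cosh p.1 * Real.cosh q.1 - Real.sinh p.1 * Real.sinh q.1 +
          Real.sinh p.1 * Real.sinh q.1 * (Real.exp (R - p.1 - q.1) / 2) := by
      nlinarith
    refine h3.trans ?_
    rw [Real.cosh_eq, Real.cosh_eq, Real.cosh_eq, Real.sinh_eq, Real.sinh_eq, Real.exp_sub,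
      Real.exp_sub]
    have eu : Real.exp p.1 = (Real.exp (-p.1))⁻¹ := by rw [Real.exp_neg, inv_inv]
    have ev : Real.exp q.1 = (Real.exp (-q.1))⁻¹ := by rw [Real.exp_neg, inv_inv]
    have ew : Real.exp R = (Real.exp (-R))⁻¹ := by rw [Real.exp_neg, inv_inv]
    rw [eu, ev, ew]
    have hu : Real.exp (-p.1) ≤ 1 := Real.exp_le_one_iff.mpr (by linarith)
    have hv : Real.exp (-q.1) ≤ 1 := Real.exp_le_one_iff.mpr (by linarith)
    have hwu : Real.exp (-R) ≤ Real.exp (-p.1) := Real.exp_le_exp.mpr (by linarith)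
    have hwv : Real.exp (-R) ≤ Real.exp (-q.1) := Real.exp_le_exp.mpr (by linarith)
    have hu0 := Real.exp_pos (-p.1)
    have hv0 := Real.exp_pos (-q.1)
    have hw0 := Real.exp_pos (-R)
    generalize Real.exp (-p.1) = u at *
    generalize Real.exp (-q.1) = v at *
    generalize Real.exp (-R) = w at *
    -- In terms of u, v, w the claim becomes (1 - u²)(1 - v²)/4 ≤ (1 - wv/u)(1 - wu/v). The product
    -- (1 - u)(1 - v) lies in between, as w ≤ u, w ≤ v and (1 + u)(1 + v) ≤ 4.
    have k1 : w * v / u ≤ v := by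
      rw [div_le_iff₀ hu0]
      nlinarith
    have k2 : w * u / v ≤ u := by
      rw [div_le_iff₀ hv0]
      nlinarith
    have k3 : (1 - v) * (1 - u) ≤ (1 - w * v / u) * (1 - w * u / v) :=
      mul_le_mul (by linarith) (by linarith) (by linarith) (by linarith)
    have k4 : (1 - u ^ 2) * (1 - v ^ 2) / 4 ≤ (1 - v) * (1 - u) := by
      have : (1 + u) * (1 + v) ≤ 4 := by nlinarith
      nlinarith [mul_nonneg (sub_nonneg.mpr hu) (sub_nonneg.mpr hv)]
    have k5 := k4.trans k3
    have e : (w⁻¹ + w) / 2 - ((u⁻¹ + u) / 2 * ((v⁻¹ + v) / 2) - (u⁻¹ - u) / 2 * ((v⁻¹ - v) / 2) +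
        (u⁻¹ - u) / 2 * ((v⁻¹ - v) / 2) * (w⁻¹ / u⁻¹ / v⁻¹ / 2)) =
        ((1 - w * v / u) * (1 - w * u / v) - (1 - u ^ 2) * (1 - v ^ 2) / 4) / (2 * w) := by
      field_simp
      ring
    have : 0 ≤ ((1 - w * v / u) * (1 - w * u / v) - (1 - u ^ 2) * (1 - v ^ 2) / 4) / (2 * w) :=
      div_nonneg (by linarith) (by linarith)
    linarith
  rwa [Real.cosh_le_cosh, abs_of_nonneg dist_nonneg, abs_of_nonneg (by linarith)] at hcosh

/-- The level of a point at distance `r` from the origin; the boundary has level `0`. -/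
noncomputable def level (T : ℕ) (R r : ℝ) : ℕ := min T (Nat.log 4 ⌊Real.exp (R - r)⌋₊)

/-- The number of the sector that contains the angle `θ`, if the circle is divided into `M`
sectors. -/
noncomputable def sector (M : ℕ) (θ : ℝ) : ℕ := ⌈θ * M / (2 * Real.pi)⌉₊ - 1

/-- The node at which a point of the disk of radius `R` is placed, in a forest of `N` trees of
height `T`. -/
noncomputable def node (R : ℝ) (T N : ℕ) (p : ℝ × ℝ) : ℕ × ℕ :=
  (level T R p.1, sector (N * 2 ^ T) p.2 / 2 ^ level T R p.1)

lemma measurable_node (R : ℝ) (T N : ℕ) : Measurable (node R T N) := by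
  have h1 : Measurable fun p : ℝ × ℝ => level T R p.1 :=
    (measurable_of_countable fun n => min T (Nat.log 4 n)).comp
      (Nat.measurable_floor.comp (by fun_prop))
  have h2 : Measurable fun p : ℝ × ℝ => sector (N * 2 ^ T) p.2 :=
    (measurable_of_countable fun n => n - 1).comp (Nat.measurable_ceil.comp (by fun_prop))
  exact h1.prodMk ((measurable_of_countable fun a : ℕ × ℕ => a.1 / 2 ^ a.2).comp (h2.prodMk h1))

lemma level_le (T : ℕ) (R r : ℝ) : level T R r ≤ T := min_le_left _ _

lemma four_pow_level_le {T : ℕ} {R r : ℝ} (h : r ≤ R) : 4 ^ level T R r ≤ Real.exp (R - r) := by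
  have h1 : 1 ≤ Real.exp (R - r) := Real.one_le_exp (by linarith)
  have h2 : ⌊Real.exp (R - r)⌋₊ ≠ 0 := (Nat.floor_pos.mpr h1).ne'
  have h3 : (4 : ℕ) ^ level T R r ≤ ⌊Real.exp (R - r)⌋₊ :=
    (Nat.pow_le_pow_right (by norm_num) (min_le_right _ _)).trans (Nat.pow_log_le_self 4 h2)
  calc (4 : ℝ) ^ level T R r = ((4 ^ level T R r : ℕ) : ℝ) := by push_cast; rfl
    _ ≤ ⌊Real.exp (R - r)⌋₊ := by exact_mod_cast h3
    _ ≤ _ := Nat.floor_le (by positivity)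

lemma level_eq {T i : ℕ} {R r : ℝ} (hi : i ≤ T) (h1 : R - (i + 1) * Real.log 4 < r)
    (h2 : r < R - i * Real.log 4) : level T R r = i := by
  have e1 : (4 : ℝ) ^ i ≤ Real.exp (R - r) := by
    rw [← Real.rpow_natCast, Real.rpow_def_of_pos (by norm_num)]
    exact Real.exp_le_exp.mpr (by linarith)
  have e2 : Real.exp (R - r) < (4 : ℝ) ^ (i + 1) := by
    rw [← Real.rpow_natCast, Real.rpow_def_of_pos (by norm_num)]
    push_cast
    exact Real.exp_lt_exp.mpr (by linarith)
  rw [level, Nat.log_eq_of_pow_le_of_lt_pow (m := i), min_eq_right hi]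
  · exact Nat.le_floor (by exact_mod_cast e1)
  · exact (Nat.floor_lt (by positivity)).mpr (by exact_mod_cast e2)

lemma sector_spec {M : ℕ} (hM : 0 < M) {θ : ℝ} (hθ : 0 < θ) :
    2 * Real.pi * sector M θ / M < θ ∧ θ ≤ 2 * Real.pi * (sector M θ + 1) / M := by
  have hpi := Real.pi_pos
  have hM' : (0 : ℝ) < M := by exact_mod_cast hM
  have hpos : 0 < θ * M / (2 * Real.pi) := by positivity
  have h1 : 0 < ⌈θ * M / (2 * Real.pi)⌉₊ := Nat.ceil_pos.mpr hpos
  have h2 : ((sector M θ : ℝ) + 1) = ⌈θ * M / (2 * Real.pi)⌉₊ := by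
    rw [sector, Nat.cast_sub (by omega)]
    simp
  have h3 := Nat.le_ceil (θ * M / (2 * Real.pi))
  have h4 := Nat.ceil_lt_add_one hpos.le
  rw [← h2] at h3 h4
  have e : θ * M = θ * M / (2 * Real.pi) * (2 * Real.pi) := by field_simp
  constructor
  · rw [div_lt_iff₀ hM', e]
    nlinarith
  · rw [le_div_iff₀ hM', e]
    nlinarith

lemma sector_eq_div {M k : ℕ} (hM : 0 < M) {θ : ℝ} (d : ℕ)
    (h1 : 2 * Real.pi * (k * d) / M < θ) (h2 : θ ≤ 2 * Real.pi * ((k + 1) * d) / M) :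
    sector M θ / d = k := by
  have hpi := Real.pi_pos
  have hM' : (0 : ℝ) < M := by exact_mod_cast hM
  have hθ : 0 < θ := lt_of_le_of_lt (by positivity) h1
  obtain ⟨h3, h4⟩ := sector_spec hM hθ
  have h5 : ((k * d : ℕ) : ℝ) < ((sector M θ + 1 : ℕ) : ℝ) := by
    have := h1.trans_le h4
    rw [div_lt_div_iff_of_pos_right hM'] at this
    push_cast
    nlinarith
  have h6 : ((sector M θ : ℕ) : ℝ) < (((k + 1) * d : ℕ) : ℝ) := by
    have := h3.trans_le h2
    rw [div_lt_div_iff_of_pos_right hM'] at this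
    push_cast
    nlinarith
  have h5' : k * d < sector M θ + 1 := by exact_mod_cast h5
  have h6' : sector M θ < (k + 1) * d := by exact_mod_cast h6
  exact Nat.div_eq_of_lt_le (by omega) h6'

lemma sector_lt {M : ℕ} (hM : 0 < M) {θ : ℝ} (h : θ ∈ Set.Ioc 0 (2 * Real.pi)) :
    sector M θ < M := by
  have hpi := Real.pi_pos
  have hM' : (0 : ℝ) < M := by exact_mod_cast hM
  have h1 := (sector_spec hM h.1).1.trans_le h.2
  rw [div_lt_iff₀ hM'] at h1
  have : (sector M θ : ℝ) < M := by nlinarith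
  exact_mod_cast this

lemma node_mem_subtree {R : ℝ} {T N : ℕ} (hN : 0 < N) {p : ℝ × ℝ}
    (hp : p ∈ Set.Ico 0 R ×ˢ Set.Ioc 0 (2 * Real.pi)) :
    ∃ k < N, node R T N p ∈ subtree T k := by
  refine ⟨sector (N * 2 ^ T) p.2 / 2 ^ T, ?_, level_le _ _ _, ?_⟩
  · rw [Nat.div_lt_iff_lt_mul (by positivity)]
    exact sector_lt (by positivity) hp.2
  · simp only [node]
    rw [Nat.div_div_eq_div_mul, ← pow_add, Nat.add_sub_cancel' (level_le _ _ _)]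

/-- With M ≥ 2πx sectors, two points of a block of 2^j sectors differ in angle by at most 2^j / x.
If j is the level of q, the square of this is 4^j / e^R ≤ e^(-q.1) ≤ e^(R - p.1 - q.1), since p.1 ≤
R; then `dist_polarPoint_le` applies. -/
lemma dist_le_of_node_mem_subtree {x R : ℝ} {T N : ℕ} (hx : 0 < x) (hR : R = 2 * Real.log x)
    (hM : 2 * Real.pi * x ≤ (N * 2 ^ T : ℕ)) {p q : ℝ × ℝ}
    (hp : p ∈ Set.Ico 0 R ×ˢ Set.Ioc 0 (2 * Real.pi))
    (hq : q ∈ Set.Ico 0 R ×ˢ Set.Ioc 0 (2 * Real.pi))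
    (h : node R T N p ∈ subtree (node R T N q).1 (node R T N q).2) :
    dist (polarPoint p) (polarPoint q) ≤ R := by
  have hpi := Real.pi_pos
  have hM0 : (0 : ℝ) < (N * 2 ^ T : ℕ) := lt_of_lt_of_le (by positivity) hM
  have hMN : 0 < N * 2 ^ T := by exact_mod_cast hM0
  obtain ⟨hp1, hp2⟩ := hp
  obtain ⟨hq1, hq2⟩ := hq
  refine dist_polarPoint_le hp1.1 hq1.1 hp1.2.le hq1.2.le ?_
  obtain ⟨h1, h2⟩ := h
  simp only [node] at h1 h2
  rw [Nat.div_div_eq_div_mul, ← pow_add, Nat.add_sub_cancel' h1] at h2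
  set j := level T R q.1 with hj
  set M := N * 2 ^ T with hMdef
  obtain ⟨a1, a2⟩ := sector_spec hMN hp2.1
  obtain ⟨b1, b2⟩ := sector_spec hMN hq2.1
  have hd : 0 < 2 ^ j := by positivity
  have s1 : sector M p.2 + 1 ≤ sector M q.2 + 2 ^ j := by
    have := Nat.div_add_mod (sector M p.2) (2 ^ j)
    have := Nat.div_add_mod (sector M q.2) (2 ^ j)
    have := Nat.mod_lt (sector M p.2) hd
    rw [h2] at *
    omega
  have s2 : sector M q.2 + 1 ≤ sector M p.2 + 2 ^ j := by
    have := Nat.div_add_mod (sector M p.2) (2 ^ j)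
    have := Nat.div_add_mod (sector M q.2) (2 ^ j)
    have := Nat.mod_lt (sector M q.2) hd
    rw [h2] at *
    omega
  have s1' : (sector M p.2 : ℝ) + 1 ≤ sector M q.2 + 2 ^ j := by exact_mod_cast s1
  have s2' : (sector M q.2 : ℝ) + 1 ≤ sector M p.2 + 2 ^ j := by exact_mod_cast s2
  have habs : |p.2 - q.2| ≤ 2 ^ j / x := by
    have hw : 2 * Real.pi * 2 ^ j / M ≤ 2 ^ j / x := by
      rw [div_le_div_iff₀ hM0 hx]
      nlinarith [pow_pos (two_pos : (0 : ℝ) < 2) j]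
    refine le_trans ?_ hw
    rw [abs_le]
    rw [div_lt_iff₀ hM0] at a1 b1
    rw [le_div_iff₀ hM0] at a2 b2
    constructor
    · rw [neg_le, le_div_iff₀ hM0]
      nlinarith
    · rw [le_div_iff₀ hM0]
      nlinarith
  have hexp : Real.exp R = x ^ 2 := by
    rw [hR, two_mul, Real.exp_add, Real.exp_log hx, sq]
  calc (p.2 - q.2) ^ 2 = |p.2 - q.2| ^ 2 := (sq_abs _).symm
    _ ≤ (2 ^ j / x) ^ 2 := by gcongr
    _ = 4 ^ j / Real.exp R := by
      rw [hexp, div_pow, ← pow_mul, mul_comm, pow_mul]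
      norm_num
    _ ≤ Real.exp (R - q.1) / Real.exp R := by
      gcongr
      exact four_pow_level_le hq1.2.le
    _ = Real.exp (-q.1) := by
      rw [← Real.exp_sub]
      congr 1
      ring
    _ ≤ _ := Real.exp_le_exp.mpr (by linarith [hp1.2])

/-- From x ≤ 4^T ≤ e^(R - r) follows R/2 = log x ≤ R - r. By the triangle inequality through the
origin, the points of the top level form a clique. -/
lemma two_mul_le_of_level_eq {x R r : ℝ} {T : ℕ} (hx : 0 < x) (hR : R = 2 * Real.log x)
    (hT : x ≤ 4 ^ T) (hr : r ≤ R) (h : level T R r = T) : 2 * r ≤ R := by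
  have h1 := four_pow_level_le (T := T) hr
  rw [h] at h1
  have h2 := Real.log_le_log hx (hT.trans h1)
  rw [Real.log_exp] at h2
  linarith

/-- Lower bound for the probability that a point is placed at a given node. -/
lemma le_quasiUniform_node {α x R : ℝ} {T N : ℕ} (hα : 0 < α) (hα' : α ≤ 1 / 2) (hx : 0 < x)
    (hR : R = 2 * Real.log x) (hM : 2 * Real.pi * x ≤ (N * 2 ^ T : ℕ))
    (hM' : (N * 2 ^ T : ℕ) ≤ 8 * x) (hT : 4 ^ T ≤ 4 * x)
    (hlarge : Real.log 2 ≤ α * Real.log (x / 16)) {i k l : ℕ} (hl : l < N)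
    (ht : (i, k) ∈ subtree T l) :
    ENNReal.ofReal (α / (32 * x) * Real.exp ((1 / 2 - α) * (i * Real.log 4))) ≤
      quasiUniform α R (node R T N ⁻¹' {(i, k)}) := by
  have hpi := Real.pi_pos
  have hM0 : (0 : ℝ) < (N * 2 ^ T : ℕ) := lt_of_lt_of_le (by positivity) hM
  have hMN : 0 < N * 2 ^ T := by exact_mod_cast hM0
  obtain ⟨hi, hkl⟩ := ht
  simp only at hi hkl
  have hlog2 : 0 < Real.log 2 := Real.log_pos (by norm_num)
  have hlog4 : Real.log 4 = 2 * Real.log 2 := by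
    rw [show (4 : ℝ) = 2 ^ 2 by norm_num, Real.log_pow]
    norm_num
  have hc : 1 ≤ Real.log 4 := by
    have := Real.log_two_gt_d9
    linarith
  set c := Real.log 4 with hcdef
  set A := R - (i + 1) * c with hA
  set M := N * 2 ^ T with hMdef
  -- Since 4^(T + 1) ≤ 16x, even the top slab starts at radius at least 2 log x - log (16x). This
  -- keeps e^(αA) ≥ 2, so that sinh is comparable to the exponential function there.
  have hAx : Real.log (x / 16) ≤ A := by
    have h1 : ((i : ℝ) + 1) * c ≤ Real.log (16 * x) := by
      have h2 : ((i : ℝ) + 1) ≤ T + 1 := by exact_mod_cast Nat.succ_le_succ hi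
      calc ((i : ℝ) + 1) * c ≤ (T + 1) * c := by gcongr
        _ = Real.log (4 ^ (T + 1)) := by rw [Real.log_pow]; push_cast; ring
        _ ≤ _ := Real.log_le_log (by positivity) (by rw [pow_succ]; linarith)
    rw [Real.log_mul (by norm_num) hx.ne'] at h1
    rw [Real.log_div hx.ne' (by norm_num), hA, hR]
    linarith
  have hαA : Real.log 2 ≤ α * A := hlarge.trans (by gcongr)
  have hA0 : 0 < A := by
    by_contra hneg
    nlinarith
  have hRA : A ≤ R := by
    rw [hA]
    have : 0 ≤ ((i : ℝ) + 1) * c := by positivity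
    linarith
  have hk : k < N * 2 ^ (T - i) := by
    rwa [← hkl, Nat.div_lt_iff_lt_mul (by positivity)] at hl
  have hkM : (k + 1) * 2 ^ i ≤ M := by
    calc (k + 1) * 2 ^ i ≤ N * 2 ^ (T - i) * 2 ^ i := Nat.mul_le_mul_right _ hk
      _ = M := by rw [mul_assoc, ← pow_add, Nat.sub_add_cancel hi]
  have hkM' : ((k : ℝ) + 1) * (2 ^ i : ℕ) ≤ M := by exact_mod_cast hkM
  set lo := 2 * Real.pi * (k * (2 ^ i : ℕ)) / M with hlo
  set hi' := 2 * Real.pi * ((k + 1) * (2 ^ i : ℕ)) / M with hhi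
  -- At the capped level i = T the node also contains points nearer to the origin; one slab of width
  -- log 4 is enough for the lower bound.
  set B : Set (ℝ × ℝ) := Set.Ioo A (R - i * c) ×ˢ Set.Ioc lo hi' with hB
  have hBnode : B ⊆ node R T N ⁻¹' {(i, k)} := by
    rintro ⟨r, θ⟩ ⟨hr, hθ⟩
    have hlev := level_eq hi hr.1 hr.2
    simp only [Set.mem_preimage, Set.mem_singleton_iff, node, hlev, Prod.mk.injEq, true_and]
    exact sector_eq_div hMN (2 ^ i) hθ.1 hθ.2
  have hBD : B ⊆ Set.Ico 0 R ×ˢ Set.Ioc 0 (2 * Real.pi) := by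
    rintro ⟨r, θ⟩ ⟨hr, hθ⟩
    refine ⟨⟨hA0.le.trans hr.1.le, hr.2.trans_le ?_⟩, ⟨lt_of_le_of_lt ?_ hθ.1, hθ.2.trans ?_⟩⟩
    · have : 0 ≤ (i : ℝ) * c := by positivity
      linarith
    · positivity
    · rw [hhi, div_le_iff₀ hM0]
      nlinarith
  have hBm : MeasurableSet B := measurableSet_Ioo.prod measurableSet_Ioc
  have hvol : volume B = ENNReal.ofReal (c * (2 * Real.pi * 2 ^ i / M)) := by
    rw [hB, Measure.volume_eq_prod, Measure.prod_prod, Real.volume_Ioo, Real.volume_Ioc,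
      ← ENNReal.ofReal_mul (by rw [hA]; nlinarith)]
    congr 1
    rw [hA, hlo, hhi]
    push_cast
    ring
  have hdens : ∀ p ∈ B, α / (4 * Real.pi) * Real.exp (-(α * ((i + 1) * c))) ≤
      α * Real.sinh (α * p.1) / (2 * Real.pi * (Real.cosh (α * R) - 1)) := by
    rintro ⟨r, θ⟩ ⟨hr, -⟩
    have h1 : Real.exp (α * A) / 4 ≤ Real.sinh (α * r) := by
      have h2 : Real.sinh (α * A) ≤ Real.sinh (α * r) :=
        Real.sinh_le_sinh.mpr (by have := hr.1.le; gcongr)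
      have h3 : 2 ≤ Real.exp (α * A) := by
        rw [← Real.exp_log (two_pos : (0 : ℝ) < 2)]
        exact Real.exp_le_exp.mpr hαA
      have h4 : Real.exp (-(α * A)) ≤ 1 := Real.exp_le_one_iff.mpr (by nlinarith)
      rw [Real.sinh_eq] at h2
      linarith
    have h5 : Real.cosh (α * R) - 1 ≤ Real.exp (α * R) / 2 := by
      have h6 : Real.exp (-(α * R)) ≤ 1 := Real.exp_le_one_iff.mpr (by nlinarith)
      rw [Real.cosh_eq]
      linarith
    have h7 : 0 < Real.cosh (α * R) - 1 := by
      have := Real.one_lt_cosh.mpr (mul_pos hα (hA0.trans_le hRA)).ne'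
      linarith
    have h8 : Real.exp (-(α * ((i + 1) * c))) * Real.exp (α * R) = Real.exp (α * A) := by
      rw [← Real.exp_add]
      congr 1
      rw [hA]
      ring
    rw [le_div_iff₀ (by positivity)]
    calc α / (4 * Real.pi) * Real.exp (-(α * ((i + 1) * c))) *
          (2 * Real.pi * (Real.cosh (α * R) - 1))
        ≤ α / (4 * Real.pi) * Real.exp (-(α * ((i + 1) * c))) *
          (2 * Real.pi * (Real.exp (α * R) / 2)) := by gcongr
      _ = α * (Real.exp (α * A) / 4) := by
        rw [← h8]
        field_simp
      _ ≤ _ := by gcongr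
  have hQB : ENNReal.ofReal (α / (4 * Real.pi) * Real.exp (-(α * ((i + 1) * c)))) * volume B ≤
      quasiUniform α R B := by
    rw [quasiUniform, withDensity_apply _ hBm, Measure.restrict_restrict hBm,
      Set.inter_eq_left.mpr hBD, ← setLIntegral_const]
    exact setLIntegral_mono' hBm fun p hp => ENNReal.ofReal_le_ofReal (hdens p hp)
  refine le_trans ?_ (hQB.trans (measure_mono hBnode))
  rw [hvol, ← ENNReal.ofReal_mul (by positivity)]
  refine ENNReal.ofReal_le_ofReal ?_
  have h2 : (2 : ℝ) ^ i = Real.exp (1 / 2 * (i * c)) := by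
    rw [← Real.rpow_natCast, Real.rpow_def_of_pos (by norm_num), hlog4]
    congr 1
    ring
  have h3 : (1 : ℝ) / 2 ≤ Real.exp (-(α * c)) := by
    rw [show (1 : ℝ) / 2 = Real.exp (-Real.log 2) by
      rw [Real.exp_neg, Real.exp_log two_pos]; norm_num]
    refine Real.exp_le_exp.mpr ?_
    rw [hlog4]
    nlinarith
  have h4 : Real.exp (-(α * ((i + 1) * c))) * 2 ^ i =
      Real.exp (-(α * c)) * Real.exp ((1 / 2 - α) * (i * c)) := by
    rw [h2, ← Real.exp_add, ← Real.exp_add]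
    congr 1
    ring
  -- The constant is 32 = 2 · 2 · 8, from density times volume having 2M in the denominator, from
  -- e^(-α log 4) ≥ 1/2, and from M ≤ 8x; log 4 is bounded below by 1. The exponent 1/2 - α compares
  -- the width 2^i of the block with the decay 4^(-αi) of the density.
  calc α / (32 * x) * Real.exp ((1 / 2 - α) * (i * c))
      = α * 1 * (1 / 2) * Real.exp ((1 / 2 - α) * (i * c)) / (2 * (8 * x)) := by ring
    _ ≤ α * c * Real.exp (-(α * c)) * Real.exp ((1 / 2 - α) * (i * c)) / (2 * M) := by gcongr
    _ = α * c * (Real.exp (-(α * ((i + 1) * c))) * 2 ^ i) / (2 * M) := by rw [h4]; ring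
    _ = _ := by
      field_simp
      ring

/-- The shape of the forest. -/
lemma exists_forest {x : ℝ} (hx : 16 ≤ x) : ∃ T N : ℕ, 0 < N ∧ x ≤ 4 ^ (T + 1) ∧
    4 ^ (T + 1) ≤ 4 * x ∧ 2 * Real.pi * x ≤ (N * 2 ^ (T + 1) : ℕ) ∧
      (N * 2 ^ (T + 1) : ℕ) ≤ 8 * x := by
  have hpi := Real.pi_pos
  have hpi' := Real.pi_lt_d2
  obtain ⟨T, hT1, hT2⟩ := exists_nat_pow_near (by linarith : (1 : ℝ) ≤ x)
    (by norm_num : (1 : ℝ) < 4)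
  have h2 : (0 : ℝ) < 2 ^ (T + 1) := by positivity
  -- Rounding up the number of trees costs at most 2^(T + 1) sectors. This is at most x/2 because
  -- its square is at most 4x ≤ x²/4 for x ≥ 16, and 2π + 1/2 < 8.
  have h3 : (2 : ℝ) ^ (T + 1) ≤ x / 2 := by
    have e : ((2 : ℝ) ^ (T + 1)) ^ 2 = 4 * 4 ^ T := by
      rw [← pow_mul, mul_comm (T + 1), pow_mul, pow_succ]
      norm_num
      ring
    refine le_of_sq_le_sq ?_ (by linarith)
    rw [e]
    nlinarith
  refine ⟨T, ⌈2 * Real.pi * x / 2 ^ (T + 1)⌉₊, Nat.ceil_pos.mpr (by positivity), hT2.le, ?_, ?_, ?_⟩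
  · rw [pow_succ]
    linarith
  · push_cast
    rw [← div_le_iff₀ h2]
    exact Nat.le_ceil _
  · have h4 := (Nat.ceil_lt_add_one (by positivity : 0 ≤ 2 * Real.pi * x / 2 ^ (T + 1))).le
    push_cast
    calc (⌈2 * Real.pi * x / 2 ^ (T + 1)⌉₊ : ℝ) * 2 ^ (T + 1)
        ≤ (2 * Real.pi * x / 2 ^ (T + 1) + 1) * 2 ^ (T + 1) := by gcongr
      _ = 2 * Real.pi * x + 2 ^ (T + 1) := by field_simp
      _ ≤ 8 * x := by nlinarith

end Geometry

/-! ### The failure probability -/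

lemma ae_mem_disk {α ν : ℝ} {n : ℕ} (hQ : IsProbabilityMeasure (quasiUniform α (radius ν n))) :
    ∀ᵐ ω ∂poissonLaw α ν n, ∀ j, ω.2 j ∈ Set.Ico 0 (radius ν n) ×ˢ Set.Ioc 0 (2 * Real.pi) := by
  rw [ae_all_iff]
  intro j
  have h1 : ∀ᵐ p ∂quasiUniform α (radius ν n),
      p ∈ Set.Ico 0 (radius ν n) ×ˢ Set.Ioc 0 (2 * Real.pi) :=
    (withDensity_absolutelyContinuous _ _).ae_le
      (ae_restrict_mem (measurableSet_Ico.prod measurableSet_Ioc))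
  exact ((measurePreserving_eval_infinitePi (fun _ : ℕ => quasiUniform α (radius ν n)) j).comp
    (measurePreserving_snd (μ := poissonMeasure (n : ℝ≥0)))).quasiMeasurePreserving.ae h1

/-- The graph is as required if no node at the top of the forest has too few points. -/
lemma poissonGraph_good {ν x : ℝ} {n T N : ℕ} (hx : 0 < x)
    (hR : radius ν n = 2 * Real.log x) (hT : x ≤ 4 ^ (T + 1)) (hN : 0 < N)
    (hM : 2 * Real.pi * x ≤ (N * 2 ^ (T + 1) : ℕ)) {ω : ℕ × (ℕ → ℝ × ℝ)}
    (hω : ∀ j, ω.2 j ∈ Set.Ico 0 (radius ν n) ×ˢ Set.Ioc 0 (2 * Real.pi))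
    (h : ∀ k < N,
      pathNumber (nodeCount fun j : Fin ω.1 => node (radius ν n) (T + 1) N (ω.2 j)) T (2 * k) +
      pathNumber (nodeCount fun j : Fin ω.1 => node (radius ν n) (T + 1) N (ω.2 j)) T (2 * k + 1) <
      nodeCount (fun j : Fin ω.1 => node (radius ν n) (T + 1) N (ω.2 j)) (T + 1, k)) :
    HasHamiltonCycle (poissonGraph ν n ω) ∧ HasNearPerfectMatching (poissonGraph ν n ω) := by
  refine hasHamiltonCycle_of_forest
    (τ := fun j : Fin ω.1 => node (radius ν n) (T + 1) N (ω.2 j)) ?_ T N hN ?_ ?_ h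
  · exact fun v w hvw hs => ⟨hvw, dist_le_of_node_mem_subtree hx hR hM (hω v) (hω w) hs⟩
  · intro v hv w hw hvw
    have h1 := two_mul_le_of_level_eq hx hR hT (hω v).1.2.le hv
    have h2 := two_mul_le_of_level_eq hx hR hT (hω w).1.2.le hw
    exact ⟨hvw, (dist_polarPoint_le_add (hω v).1.1 (hω w).1.1).trans (by linarith)⟩
  · exact fun v => node_mem_subtree hN (hω v)

/-- A union bound over the at most 8x top nodes, each of which fails with probability at most 16
exp(-(να/64) x^(1/2 - α)), gives 128 = 8 · 16. -/
lemma poissonLaw_bad_le {α ν : ℝ} {n : ℕ} (hα : 0 < α) (hα' : α < 1 / 2) (hν : 192 / α < ν)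
    (hx16 : 16 ≤ n / ν) (hlarge : Real.log 2 ≤ α * Real.log (n / ν / 16)) :
    (poissonLaw α ν n).real
        {ω | ¬ (HasHamiltonCycle (poissonGraph ν n ω) ∧
          HasNearPerfectMatching (poissonGraph ν n ω))} ≤
      128 * ((n / ν) * Real.exp (-(ν * α / 64) * (n / ν) ^ (1 / 2 - α))) := by
  have hν0 : 0 < ν := lt_trans (by positivity) hν
  obtain ⟨T, N, hN, hT, hT', hM, hM'⟩ := exists_forest hx16
  set x := (n : ℝ) / ν with hxdef
  have hx : 0 < x := by linarith
  have hnx : (n : ℝ) = ν * x := by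
    rw [hxdef]
    field_simp
  have hRdef : radius ν n = 2 * Real.log x := rfl
  have hR0 : 0 < radius ν n := by
    rw [hRdef]
    have := Real.log_pos (by linarith : 1 < x)
    linarith
  have hQ := isProbabilityMeasure_quasiUniform hα hR0
  have hP : IsProbabilityMeasure (poissonLaw α ν n) := by
    unfold poissonLaw
    infer_instance
  set R := radius ν n with hR
  have hmeas := measurable_node R (T + 1) N
  set X : ℕ × ℕ → ℕ × (ℕ → ℝ × ℝ) → ℕ := fun t ω =>
    nodeCount (fun j : Fin ω.1 => node R (T + 1) N (ω.2 j)) t with hX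
  have hXm : ∀ t, Measurable (X t) := fun t => measurable_nodeCount hmeas t
  obtain ⟨hind, hlaw⟩ := poisson_thinning (quasiUniform α R) (n : ℝ≥0) hmeas
  change iIndepFun X (poissonLaw α ν n) at hind
  have hlint : ∀ l < N, ∀ t ∈ subtree (T + 1) l, ∫⁻ ω, 2⁻¹ ^ X t ω ∂poissonLaw α ν n ≤
      ENNReal.ofReal (Real.exp (-(ν * α / 64 *
        Real.exp ((1 / 2 - α) * (t.1 * Real.log 4))))) := by
    rintro l hl ⟨i, k⟩ ht
    have h1 := le_quasiUniform_node hα hα'.le hx hRdef hM hM' hT' hlarge hl ht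
    have h2 : ∫⁻ ω, 2⁻¹ ^ X (i, k) ω ∂poissonLaw α ν n =
        ∫⁻ m, 2⁻¹ ^ m ∂((poissonLaw α ν n).map (X (i, k))) :=
      (lintegral_map (f := fun m : ℕ => (2⁻¹ : ℝ≥0∞) ^ m) (measurable_of_countable _)
        (hXm _)).symm
    have h3 : (poissonLaw α ν n).map (X (i, k)) = _ := hlaw (i, k)
    rw [h2, h3, lintegral_half_pow_poissonMeasure]
    refine ENNReal.ofReal_le_ofReal (Real.exp_le_exp.mpr (neg_le_neg ?_))
    rw [ENNReal.ofReal_le_iff_le_toReal (measure_ne_top _ _)] at h1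
    have h4 : ((n : ℝ≥0) * (quasiUniform α R (node R (T + 1) N ⁻¹' {(i, k)})).toNNReal : ℝ≥0) =
        (n : ℝ) * (quasiUniform α R (node R (T + 1) N ⁻¹' {(i, k)})).toReal := by
      push_cast
      rfl
    rw [h4, hnx]
    -- The mean is n = νx times the node probability, which cancels x; the factor 1/2 from the
    -- generating function turns 32 into 64.
    calc ν * α / 64 * Real.exp ((1 / 2 - α) * (i * Real.log 4))
        = ν * x * (α / (32 * x) * Real.exp ((1 / 2 - α) * (i * Real.log 4))) / 2 := by
          field_simp
          ring
      _ ≤ _ := by gcongr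
  have hlog4 : 0 ≤ Real.log 4 := Real.log_nonneg (by norm_num)
  have hsmall : ∀ l < N, ∀ t ∈ subtree (T + 1) l,
      ∫⁻ ω, 2⁻¹ ^ X t ω ∂poissonLaw α ν n ≤ 8⁻¹ := by
    intro l hl t ht
    refine (hlint l hl t ht).trans ?_
    -- This is where 192 = 3 · 64 comes from: e^(-3) ≤ 1/8. Since α < 1/2, the higher levels only
    -- improve the exponent.
    have h1 : 3 ≤ ν * α / 64 := by
      rw [div_lt_iff₀ hα] at hν
      linarith
    have h2 : 1 ≤ Real.exp ((1 / 2 - α) * (t.1 * Real.log 4)) :=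
      Real.one_le_exp (mul_nonneg (by linarith) (by positivity))
    have h3 : (8 : ℝ) ≤ Real.exp 3 := by
      have := Real.exp_one_gt_d9
      calc (8 : ℝ) = 2 ^ 3 := by norm_num
        _ ≤ Real.exp 1 ^ 3 := by gcongr; linarith
        _ = _ := by rw [← Real.exp_nat_mul]; norm_num
    have h4 : Real.exp (-(ν * α / 64 * Real.exp ((1 / 2 - α) * (t.1 * Real.log 4)))) ≤ 8⁻¹ := by
      rw [Real.exp_neg]
      refine inv_anti₀ (by norm_num) (h3.trans (Real.exp_le_exp.mpr ?_))
      nlinarith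
    calc _ ≤ ENNReal.ofReal 8⁻¹ := ENNReal.ofReal_le_ofReal h4
      _ = 8⁻¹ := by
        rw [ENNReal.ofReal_inv_of_pos (by norm_num)]
        norm_num
  have htop : ∀ k < N, (poissonLaw α ν n).real {ω | X (T + 1, k) ω ≤
      pathNumber (fun t => X t ω) T (2 * k) + pathNumber (fun t => X t ω) T (2 * k + 1)} ≤
      16 * Real.exp (-(ν * α / 64) * x ^ (1 / 2 - α)) := by
    intro k hk
    have h1 := (measure_le_pathNumber_le hXm hind T k (hsmall k hk)).trans
      (mul_le_mul_right (hlint k hk _ (self_mem_subtree (T + 1) k)) 16)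
    rw [show (16 : ℝ≥0∞) = ENNReal.ofReal 16 by norm_num, ← ENNReal.ofReal_mul (by norm_num)] at h1
    refine (ENNReal.toReal_le_of_le_ofReal (by positivity) h1).trans ?_
    -- The top level is T + 1, and 4^(T + 1) ≥ x.
    have h2 : x ^ (1 / 2 - α) ≤ Real.exp ((1 / 2 - α) * (((T + 1 : ℕ) : ℝ) * Real.log 4)) := by
      rw [Real.rpow_def_of_pos hx, mul_comm]
      refine Real.exp_le_exp.mpr (mul_le_mul_of_nonneg_left ?_ (by linarith))
      rw [← Real.log_pow]
      exact Real.log_le_log hx hT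
    rw [neg_mul]
    gcongr
  have hsub : {ω | ¬ (HasHamiltonCycle (poissonGraph ν n ω) ∧
          HasNearPerfectMatching (poissonGraph ν n ω))} ⊆
      {ω | ¬ ∀ j, ω.2 j ∈ Set.Ico 0 R ×ˢ Set.Ioc 0 (2 * Real.pi)} ∪
      ⋃ k ∈ Finset.range N, {ω | X (T + 1, k) ω ≤
      pathNumber (fun t => X t ω) T (2 * k) + pathNumber (fun t => X t ω) T (2 * k + 1)} := by
    intro ω hω
    by_contra hcon
    simp only [Set.mem_union, Set.mem_ofPred_eq, not_or, not_not, Set.mem_iUnion, not_exists,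
      not_le, Finset.mem_range] at hcon
    exact hω (poissonGraph_good hx hRdef hT hN hM hcon.1 hcon.2)
  have hnull : (poissonLaw α ν n).real
      {ω | ¬ ∀ j, ω.2 j ∈ Set.Ico 0 R ×ˢ Set.Ioc 0 (2 * Real.pi)} = 0 := by
    rw [measureReal_def, ae_iff.mp (ae_mem_disk hQ), ENNReal.toReal_zero]
  have hN8 : (N : ℝ) ≤ 8 * x := by
    refine le_trans ?_ hM'
    exact_mod_cast Nat.le_mul_of_pos_right N (by positivity)
  calc _ ≤ _ := measureReal_mono hsub
    _ ≤ _ := measureReal_union_le _ _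
    _ ≤ 0 + ∑ k ∈ Finset.range N, 16 * Real.exp (-(ν * α / 64) * x ^ (1 / 2 - α)) :=
      add_le_add hnull.le ((measureReal_biUnion_finset_le _ _).trans
        (Finset.sum_le_sum fun k hk => htop k (Finset.mem_range.mp hk)))
    _ = N * (16 * Real.exp (-(ν * α / 64) * x ^ (1 / 2 - α))) := by simp
    _ ≤ 8 * x * (16 * Real.exp (-(ν * α / 64) * x ^ (1 / 2 - α))) := by gcongr
    _ = _ := by ring

lemma isLittleO_mul_exp_neg_rpow {b γ : ℝ} (hb : 0 < b) (hγ : 0 < γ) :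
    (fun x : ℝ => x * Real.exp (-b * x ^ γ)) =o[atTop] fun x => x ^ (-(1 / 2) : ℝ) := by
  -- In the variable y = x^γ the exponential is o(y^s). The choice s = -(3/2)/γ makes this
  -- o(x^(-3/2)), which leaves x^(-1/2) after multiplication by x.
  have h1 := (isLittleO_exp_neg_mul_rpow_atTop hb (-(3 / 2) / γ)).comp_tendsto
    (tendsto_rpow_atTop hγ)
  have h2 := (isBigO_refl (fun x : ℝ => x) atTop).mul_isLittleO h1
  refine h2.congr' (Eventually.of_forall fun x => rfl) ?_
  filter_upwards [eventually_gt_atTop 0] with x hx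
  simp only [Function.comp_apply]
  rw [← Real.rpow_mul hx.le, mul_div_cancel₀ _ hγ.ne']
  nth_rewrite 1 [← Real.rpow_one x]
  rw [← Real.rpow_add hx]
  norm_num

end KPKVB

theorem mainTheorem3 (α : ℝ) (hα0 : 0 < α) (hα : α < 1 / 2) :
    ∃ ν₁ : ℝ, 0 < ν₁ ∧ ∀ ν : ℝ, ν₁ < ν →
      (fun n : ℕ => (KPKVB.poissonLaw α ν n).real
        {ω | ¬ (KPKVB.HasHamiltonCycle (KPKVB.poissonGraph ν n ω) ∧
          KPKVB.HasNearPerfectMatching (KPKVB.poissonGraph ν n ω))})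
        =o[atTop] fun n : ℕ => (n : ℝ) ^ (-(1 / 2) : ℝ) := by
  -- Beyond this threshold the expectation of 2^(-X) is at most 1/8 at every node, as the recursion
  -- for the path numbers needs.
  refine ⟨192 / α, by positivity, fun ν hν => ?_⟩
  have hν0 : 0 < ν := lt_trans (by positivity) hν
  have hlim : Tendsto (fun n : ℕ => (n : ℝ) / ν) atTop atTop :=
    tendsto_natCast_atTop_atTop.atTop_div_const hν0
  have hlog : Tendsto (fun n : ℕ => α * Real.log ((n : ℝ) / ν / 16)) atTop atTop :=
    (Real.tendsto_log_atTop.comp (hlim.atTop_div_const (by norm_num))).const_mul_atTop hα0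
  have hlittle := (KPKVB.isLittleO_mul_exp_neg_rpow (b := ν * α / 64) (γ := 1 / 2 - α)
    (by positivity) (by linarith)).comp_tendsto hlim
  have hbound : (fun n : ℕ => (KPKVB.poissonLaw α ν n).real
        {ω | ¬ (KPKVB.HasHamiltonCycle (KPKVB.poissonGraph ν n ω) ∧
          KPKVB.HasNearPerfectMatching (KPKVB.poissonGraph ν n ω))}) =O[atTop]
      ((fun x : ℝ => x * Real.exp (-(ν * α / 64) * x ^ (1 / 2 - α))) ∘
        fun n : ℕ => (n : ℝ) / ν) := by
    refine IsBigO.of_bound 128 ?_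
    filter_upwards [hlim.eventually_ge_atTop 16, hlog.eventually_ge_atTop (Real.log 2)]
      with n h1 h2
    rw [Real.norm_of_nonneg measureReal_nonneg, Function.comp_apply, Real.norm_of_nonneg
      (mul_nonneg (by linarith) (Real.exp_pos _).le)]
    exact KPKVB.poissonLaw_bad_le hα0 hα hν h1 h2
  refine (hbound.trans_isLittleO hlittle).trans_isBigO ?_
  -- Passing from (n/ν)^(-1/2) to n^(-1/2) costs a constant factor that depends only on ν.
  refine IsBigO.of_bound ‖ν⁻¹ ^ (-(1 / 2) : ℝ)‖ (Eventually.of_forall fun n => ?_)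
  rw [Function.comp_apply, div_eq_mul_inv, Real.mul_rpow (by positivity) (by positivity), norm_mul,
    mul_comm]
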